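/- Let $N\ge 1$, $0<s<1$, $n\ge 0$, $\varepsilon>0$, and let $\phi(u)=-u^{-n}$ if $n>0$, $\phi(u)=\log u$ if $n=0$ ($u>0$). For $\psi\in C_c^\infty(\mathbb R^N)$ let $$(-\Delta)^{s/2}\psi(x)=c(N,s/2)\,\mathrm{p.v.}\!\int_{\mathbb R^N}\frac{\psi(x)-\psi(y)}{|x-y|^{N+s}}\,dy,\qquad c(N,\sigma)=\frac{4^{\sigma}\,\Gamma(N/2+\sigma)}{\pi^{N/2}\,|\Gamma(-\sigma)|},$$ and let $\dot H^s(\mathbb R^N)$ be the completion of $C_c^\infty(\mathbb R^N)$ in the norm $\|(-\Delta)^{s/2}\psi\|_{L^2}$, realised by functions: $w\in L^1_{loc}$ belongs to $\dot H^s$, with $(-\Delta)^{s/2}w=g\in L^2$, if there are $\psi_k\in C_c^\infty$ with $\psi_k\to w$ in $L^1_{loc}$ and $(-\Delta)^{s/2}\psi_k\to g$ in $L^2$. Given $f\in L^1(\mathbb R^N)$, a weak solution of $u+(-\Delta)^s\phi(u)=f$ is a nonnegative $u\in L^1(\mathbb R^N)$ with $\phi(u)\in\dot H^s(\mathbb R^N)$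 (in particular $u>0$ a.e., because $\phi(0+)=-\infty$) and $$\int_{\mathbb R^N}u\psi\,dx+\int_{\mathbb R^N}(-\Delta)^{s/2}\phi(u)\,(-\Delta)^{s/2}\psi\,dx=\int_{\mathbb R^N}f\psi\,dx\qquad\text{for all }\psi\in C_c^\infty(\mathbb R^N).$$ Let $\phi_\varepsilon(v)=\phi(v+\varepsilon)-\phi(\varepsilon)$ for $v>-\varepsilon$. Weak solutions $v>-\varepsilon$ of $v+(-\Delta)^s\phi_\varepsilon(v)=f$ are defined in the same way, with $v\in L^1$ and $\phi_\varepsilon(v)\in\dot H^s$. An approximate solution $u_\varepsilon$, i.e. a solution of $u_\varepsilon+(-\Delta)^s\phi(u_\varepsilon)=f+\varepsilon$, is a function $u_\varepsilon=v_\varepsilon+\varepsilon$ with $v_\varepsilon\in L^1(\mathbb R^N)$, where $v_\varepsilon$ is a weak solution of $v+(-\Delta)^s\phi_\varepsilon(v)=f$ or, more generally, the $L^1$-limit of weak solutions $v_k$ of $v_k+(-\Delta)^s\phi_\varepsilon(v_k)=f_k$ with $f_k\in L^1(\mathbb R^N)$, $f_k\to f$ in $L^1(\mathbb R^N)$. Then,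 for every $f\in L^1(\mathbb R^N)$, every weak solution $u$ of $u+(-\Delta)^s\phi(u)=f$ and every approximate solution $u_\varepsilon$ with right-hand side $f+\varepsilon$, $$u\le u_\varepsilon\qquad\text{a.e. in }\mathbb R^N.$$ -/

import Mathlib

open MeasureTheory Filter Topology
open scoped ContDiff

namespace SingularDiffusion

noncomputable section

/-- The space `ℝ^N` with its Euclidean norm. -/
abbrev Space (N : ℕ) : Type := EuclideanSpace ℝ (Fin N)

/-- The singular nonlinearity on `(0, ∞)`: `φ_n(u) = -u^{-n}` for `n > 0`, `φ_0(u) = log u`.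
Its value at `u ≤ 0` is meaningless and is never used: all functions it is applied to below are
required to be positive almost everywhere. -/
def phi (n u : ℝ) : ℝ := if n = 0 then Real.log u else -(u ^ (-n))

/-- The displaced nonlinearity `φ_ε(v) = φ(v + ε) - φ(ε)`, defined for `v > -ε`. -/
def phiShift (n ε v : ℝ) : ℝ := phi n (v + ε) - phi n ε

/-- The normalising constant
`c(N,σ) = 4^σ Γ(N/2 + σ) / (π^{N/2} |Γ(-σ)|)`, with `|Γ(-σ)| = Γ(1 - σ) / σ` for `0 < σ < 1`. -/
def fracConst (N : ℕ) (σ : ℝ) : ℝ :=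
  4 ^ σ * σ * Real.Gamma ((N : ℝ) / 2 + σ) / (Real.pi ^ ((N : ℝ) / 2) * Real.Gamma (1 - σ))

/-- The fractional Laplacian `(-Δ)^σ`, `0 < σ < 1`, as a principal value integral.
It is only applied to smooth compactly supported functions, for which the limit exists. -/
def fracLap {N : ℕ} (σ : ℝ) (ψ : Space N → ℝ) (x : Space N) : ℝ :=
  fracConst N σ *
    limUnder (𝓝[>] (0 : ℝ)) fun r : ℝ =>
      ∫ y in (Metric.ball x r)ᶜ, (ψ x - ψ y) / ‖x - y‖ ^ ((N : ℝ) + 2 * σ)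

/-- The test functions `C_c^∞(ℝ^N)`. -/
def IsTest {N : ℕ} (ψ : Space N → ℝ) : Prop := ContDiff ℝ ∞ ψ ∧ HasCompactSupport ψ

/-- `w` belongs to the homogeneous space `Ḣ^s(ℝ^N)` and `(-Δ)^{s/2} w = g`.
Here `Ḣ^s(ℝ^N)` is the completion of `C_c^∞(ℝ^N)` with respect to
`‖ψ‖ = ‖(-Δ)^{s/2} ψ‖_{L²}`, realised by locally integrable functions: `w` is the limit in
`L^1_loc` of test functions `ψ_k` for which `(-Δ)^{s/2} ψ_k` converges to `g` in `L²`. -/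
structure HasHalfLap {N : ℕ} (s : ℝ) (w g : Space N → ℝ) : Prop where
  locallyIntegrable : LocallyIntegrable w volume
  memLp : MemLp g 2 volume
  approx : ∃ ψ : ℕ → Space N → ℝ, (∀ k, IsTest (ψ k)) ∧
    (∀ K : Set (Space N), IsCompact K →
      Tendsto (fun k => eLpNorm (fun x => ψ k x - w x) 1 (volume.restrict K)) atTop (𝓝 0)) ∧
    Tendsto (fun k => eLpNorm (fun x => fracLap (s / 2) (ψ k) x - g x) 2 volume) atTop (𝓝 0)

/-- `v ∈ L¹`, `Φ(v) ∈ Ḣ^s` and `v + (-Δ)^s Φ(v) = f` in the weak energy sense: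
`∫ v ψ + ∫ (-Δ)^{s/2} Φ(v) (-Δ)^{s/2} ψ = ∫ f ψ` for all test functions `ψ`. -/
def EnergyEquation {N : ℕ} (s : ℝ) (Φ : ℝ → ℝ) (f v : Space N → ℝ) : Prop :=
  Integrable v volume ∧
  ∃ g : Space N → ℝ, HasHalfLap s (fun x => Φ (v x)) g ∧
    ∀ ψ : Space N → ℝ, IsTest ψ →
      (∫ x, v x * ψ x) + (∫ x, g x * fracLap (s / 2) ψ x) = ∫ x, f x * ψ x

/-- Nonnegative weak solutions of `u + (-Δ)^s φ_n(u) = f`. Since `φ_n(0+) = -∞` and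
`φ_n(u)` has to be a locally integrable function, such `u` are positive almost everywhere. -/
def IsWeakSolution {N : ℕ} (s n : ℝ) (f u : Space N → ℝ) : Prop :=
  (∀ᵐ x, 0 < u x) ∧ EnergyEquation s (phi n) f u

/-- `v` is a weak solution of the displaced problem `v + (-Δ)^s φ_ε(v) = f`, that is
`v + ε` is a weak solution at level `ε` of the original equation with right-hand side `f + ε`.
(For `f ≥ 0` one has `v ≥ 0`; in general only `v + ε > 0`, which is needed for `φ_ε(v)` to make
sense, is required.) -/
def IsShiftedWeakSolution {N : ℕ} (s n ε : ℝ) (f v : Space N → ℝ) : Prop :=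
  (∀ᵐ x, 0 < v x + ε) ∧ EnergyEquation s (phiShift n ε) f v

/-- `uε` is the approximate solution, solving `uε + (-Δ)^s φ_n(uε) = f + ε`: one has
`uε = v + ε` with `v ∈ L¹`, where `v` is the limit in `L¹` of weak solutions `v_k` of the displaced
problem with right-hand sides `f_k → f` in `L¹`. If `v` is itself a weak solution with right-hand
side `f` (for instance when `f` is bounded), the constant sequences do; for unbounded `f ∈ L¹` the
solution is obtained by such an approximation. -/
def IsApproxSolution {N : ℕ} (s n ε : ℝ) (f uε : Space N → ℝ) : Prop :=
  Integrable (fun x => uε x - ε) volume ∧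
  ∃ fk vk : ℕ → Space N → ℝ,
    (∀ k, Integrable (fk k) volume) ∧
    (∀ k, IsShiftedWeakSolution s n ε (fk k) (vk k)) ∧
    Tendsto (fun k => eLpNorm (fun x => fk k x - f x) 1 volume) atTop (𝓝 0) ∧
    Tendsto (fun k => eLpNorm (fun x => vk k x - (uε x - ε)) 1 volume) atTop (𝓝 0)

end

end SingularDiffusion

namespace SingularDiffusion

noncomputable section

open Set
open scoped RealInnerProductSpace FourierTransform ComplexConjugate

/-! The proof is an `L¹` comparison argument: test the difference of the two equations with a
smoothed Heaviside function of the difference of the nonlinearities. For a displaced solution `v`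
with datum `f'`, put `W = φ(u) - φ_ε(v)` and `h = (u - v) - (f - f')`, so that `h + (-Δ)^s W = 0`
weakly. Since `W - φ(ε) = φ(u) - φ(v + ε)`, the set where `u > v + ε` is exactly `{W > φ(ε)}`. If
`q_j` increases to the indicator of `(φ(ε), ∞)`, then `∫ h q_j(W) ≤ 0` gives in the limit `∫ (u - v
- ε)⁺ ≤ ‖f - f'‖₁`, and letting the data converge in `L¹` gives `u ≤ u_ε`.

Two points need care. First, `q_j(0)` need not vanish, so only `q_j - q_j(0)` is admissible; the
missing constant costs `q_j(0) ∫ h`. If `N ≤ 2s`, constants are limits of test functions with no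
energy contribution, and `∫ h = 0` (`HasHalfLap.integral_eq_zero`). If `2s < N`, elements of `Ḣ^s`
tend to zero at infinity in mean, whereas an integrable `u` forces `φ(u) ≤ -1` outside a set of
finite measure; hence no weak solution exists (`not_hasHalfLap_phi`) and there is nothing to prove.

Second, `W` is only a limit of test functions `ψ_k`. The composition `p(ψ_k)` is again a test
function when `p` is smooth and `p 0 = 0`. The energy is a positive multiple of a double integral of
products of differences (`IsTest.exists_integral_fracLap_mul_eq`, by Fourier transform). It is
therefore nonnegative on the pair `ψ_k`, `p(ψ_k)` for nondecreasing `p`, and a Lipschitz bound on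
`p` controls the energy of `p(ψ_k)`, so the error made in replacing `W` by `ψ_k` vanishes
(`HasHalfLap.integral_mul_comp_nonpos`). -/

/-! ### The singular kernel `‖z‖^{-(N+a)}` -/

/-- The singular kernel `z ↦ ‖z‖^{-(N+a)}` on `ℝ^N`. -/
def kernel {N : ℕ} (a : ℝ) (z : Space N) : ℝ := (‖z‖ ^ ((N : ℝ) + a))⁻¹

theorem kernel_nonneg {N : ℕ} (a : ℝ) (z : Space N) : 0 ≤ kernel a z := by
  unfold kernel; positivity

@[fun_prop]
theorem measurable_kernel {N : ℕ} (a : ℝ) : Measurable (kernel a : Space N → ℝ) := by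
  unfold kernel; fun_prop

/-- In polar coordinates the integrand is `r^(m-a-1)` near the origin and `r^(-a-1)` at infinity. -/
theorem integrable_min_mul_kernel {N : ℕ} (hN : 1 ≤ N) {a m : ℝ} (ha : 0 < a) (ham : a < m) :
    Integrable (fun z : Space N => min 1 (‖z‖ ^ m) * kernel a z) := by
  have : Nonempty (Fin N) := ⟨⟨0, hN⟩⟩
  have : Nontrivial (Space N) := inferInstance
  have key := integrable_fun_norm_addHaar (volume : Measure (Space N))
    (f := fun y : ℝ => min 1 (y ^ m) * (y ^ ((N : ℝ) + a))⁻¹)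
  refine key.2 ?_
  rw [finrank_euclideanSpace_fin, ← Ioc_union_Ioi_eq_Ioi (zero_le_one' ℝ)]
  have hpow : ∀ y : ℝ, 0 < y → y ^ (N - 1) * (y ^ ((N : ℝ) + a))⁻¹ = y ^ (-a - 1) := by
    intro y hy
    rw [← Real.rpow_natCast, ← Real.rpow_neg hy.le, ← Real.rpow_add hy, Nat.cast_sub hN]
    congr 1; push_cast; ring
  refine IntegrableOn.union ?_ ?_
  · have h1 : IntegrableOn (fun y : ℝ => y ^ (m - a - 1)) (Ioc 0 1) := by
      rw [← intervalIntegrable_iff_integrableOn_Ioc_of_le zero_le_one]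
      exact intervalIntegral.intervalIntegrable_rpow' (by linarith)
    refine h1.congr_fun (fun y hy => ?_) measurableSet_Ioc
    have hle : y ^ m ≤ 1 := Real.rpow_le_one hy.1.le hy.2 (by linarith)
    simp only [smul_eq_mul]
    rw [min_eq_right hle, mul_left_comm, hpow y hy.1, ← Real.rpow_add hy.1]
    congr 1; ring
  · have h1 : IntegrableOn (fun y : ℝ => y ^ (-a - 1)) (Ioi 1) :=
      integrableOn_Ioi_rpow_of_lt (by linarith) one_pos
    refine h1.congr_fun (fun y hy => ?_) measurableSet_Ioi
    have hy1 : (1 : ℝ) < y := hy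
    have hle : 1 ≤ y ^ m := Real.one_le_rpow hy1.le (by linarith)
    simp only [smul_eq_mul]
    rw [min_eq_left hle, one_mul, hpow y (by linarith)]

theorem integrable_min_one_mul_kernel {N : ℕ} (hN : 1 ≤ N) {a : ℝ} (ha : 0 < a) (ha1 : a < 1) :
    Integrable (fun z : Space N => min 1 ‖z‖ * kernel a z) := by
  simpa using integrable_min_mul_kernel hN ha ha1

theorem kernel_smul {N : ℕ} (a : ℝ) {t : ℝ} (ht : 0 < t) (z : Space N) :
    kernel a (t • z) = (t ^ N)⁻¹ * t ^ (-a) * kernel a z := by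
  unfold kernel
  rw [norm_smul, Real.norm_of_nonneg ht.le, Real.mul_rpow ht.le (norm_nonneg _), mul_inv,
    Real.rpow_add ht, Real.rpow_natCast, Real.rpow_neg ht.le, mul_inv]

/-- Integrating a function of `⟪z, ξ⟫` against the kernel gives a multiple of `‖ξ‖ ^ a`. -/
theorem integral_kernel_smul_comp_inner {N : ℕ} {F : Type*} [NormedAddCommGroup F]
    [NormedSpace ℝ F] {a : ℝ} (ha : 0 < a) (g : ℝ → F) (hg : g 0 = 0) {e : Space N}
    (he : ‖e‖ = 1) (ξ : Space N) :
    ∫ z : Space N, kernel a z • g ⟪z, ξ⟫ = ‖ξ‖ ^ a • ∫ z : Space N, kernel a z • g ⟪z, e⟫ := by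
  rcases eq_or_ne ξ 0 with rfl | hξ
  · simp [hg, Real.zero_rpow ha.ne']
  have ht : 0 < ‖ξ‖ := norm_pos_iff.2 hξ
  -- This reflection exchanges the unit vectors `e` and `ξ/‖ξ‖`; rotation invariance reduces the
  -- claim to a dilation by `‖ξ‖`.
  set R := (ℝ ∙ (e - ‖ξ‖⁻¹ • ξ))ᗮ.reflection
  have hR : R e = ‖ξ‖⁻¹ • ξ := Submodule.reflection_sub (by
    rw [norm_smul, norm_inv, norm_norm, inv_mul_cancel₀ ht.ne', he])
  have hrot : ∫ z : Space N, kernel a z • g ⟪z, e⟫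
      = ∫ z : Space N, kernel a z • g ⟪z, ‖ξ‖⁻¹ • ξ⟫ := by
    rw [← hR, ← R.measurePreserving.integral_comp R.toHomeomorph.measurableEmbedding
      (fun z => kernel a z • g ⟪z, R e⟫)]
    simp only [kernel, LinearIsometryEquiv.norm_map, R.inner_map_map]
  have hsc := Measure.integral_comp_smul (volume : Measure (Space N))
    (fun z => kernel a z • g ⟪z, ‖ξ‖⁻¹ • ξ⟫) ‖ξ‖
  rw [finrank_euclideanSpace_fin, abs_of_pos (by positivity)] at hsc
  have h2 : ∀ z : Space N, kernel a (‖ξ‖ • z) • g ⟪‖ξ‖ • z, ‖ξ‖⁻¹ • ξ⟫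
      = ((‖ξ‖ ^ N)⁻¹ * ‖ξ‖ ^ (-a)) • kernel a z • g ⟪z, ξ⟫ := by
    intro z
    rw [kernel_smul a ht, real_inner_smul_left, real_inner_smul_right, mul_inv_cancel_left₀ ht.ne',
      smul_smul]
  simp only [h2] at hsc
  rw [integral_smul, mul_smul] at hsc
  have h3 := smul_right_injective F (inv_ne_zero (pow_ne_zero N ht.ne')) hsc
  rw [hrot, ← h3, smul_smul, ← Real.rpow_add ht, add_neg_cancel, Real.rpow_zero, one_smul]

/-! ### The symbol `1 - e^{-2πit}` -/

/-- The symbol `t ↦ 1 - e^{-2πit}` of the difference operator. -/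
def diffSymbol (t : ℝ) : ℂ := 1 - (𝐞 (-t) : ℂ)

@[fun_prop]
theorem continuous_diffSymbol : Continuous diffSymbol := by
  unfold diffSymbol
  have := Real.continuous_fourierChar
  fun_prop

theorem diffSymbol_zero : diffSymbol 0 = 0 := by simp [diffSymbol]

theorem diffSymbol_eq (t : ℝ) :
    diffSymbol t = 1 - (Real.cos (2 * Real.pi * t) - Real.sin (2 * Real.pi * t) * Complex.I) := by
  rw [diffSymbol, Real.fourierChar_apply, Complex.exp_mul_I]
  push_cast
  rw [mul_neg, Complex.cos_neg, Complex.sin_neg]; ring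

theorem re_diffSymbol (t : ℝ) : (diffSymbol t).re = 1 - Real.cos (2 * Real.pi * t) := by
  rw [diffSymbol_eq]
  simp [-Complex.ofReal_cos, -Complex.ofReal_sin]

/-- This turns the complex integral defining the symbol constant into a positive one: its real part
is half of an integral of squares. -/
theorem norm_sq_diffSymbol (t : ℝ) : ‖diffSymbol t‖ ^ 2 = 2 * (diffSymbol t).re := by
  rw [re_diffSymbol, diffSymbol_eq, Complex.sq_norm, Complex.normSq_apply]
  simp [-Complex.ofReal_cos, -Complex.ofReal_sin]
  nlinarith [Real.sin_sq_add_cos_sq (2 * Real.pi * t)]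

theorem norm_diffSymbol_le_two (t : ℝ) : ‖diffSymbol t‖ ≤ 2 := by
  refine (norm_sub_le _ _).trans ?_
  rw [norm_one, Circle.norm_coe]; norm_num

theorem norm_diffSymbol_le (t : ℝ) : ‖diffSymbol t‖ ≤ 2 * Real.pi * |t| := by
  have h : ‖diffSymbol t‖ ^ 2 ≤ (2 * Real.pi * |t|) ^ 2 := by
    rw [norm_sq_diffSymbol, re_diffSymbol, mul_pow, sq_abs]
    nlinarith [Real.one_sub_sq_div_two_le_cos (x := 2 * Real.pi * t)]
  exact le_of_sq_le_sq h (by positivity)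

theorem norm_diffSymbol_pos {t : ℝ} (h0 : 0 < t) (h1 : t < 1) : 0 < ‖diffSymbol t‖ := by
  have h : 0 < ‖diffSymbol t‖ ^ 2 := by
    rw [norm_sq_diffSymbol, re_diffSymbol]
    have hpi := Real.pi_pos
    rcases (Real.cos_le_one (2 * Real.pi * t)).lt_or_eq with h | h
    · linarith
    · rw [Real.cos_eq_one_iff] at h
      obtain ⟨k, hk⟩ := h
      have : (k : ℝ) = t := by
        have : 2 * Real.pi * ((k : ℝ) - t) = 0 := by linarith
        rcases mul_eq_zero.1 this with h | h
        · linarith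
        · linarith
      rw [← this] at h0 h1
      norm_cast at h0 h1
      omega
  by_contra hc
  have : ‖diffSymbol t‖ = 0 := le_antisymm (not_lt.1 hc) (norm_nonneg _)
  simp [this] at h

theorem norm_diffSymbol_inner_le {N : ℕ} (z ξ : Space N) :
    ‖diffSymbol ⟪z, ξ⟫‖ ≤ (2 + 2 * Real.pi * ‖ξ‖) * min 1 ‖z‖ := by
  have hpi := Real.pi_pos
  have h1 := norm_diffSymbol_le_two ⟪z, ξ⟫
  have h2 := (norm_diffSymbol_le ⟪z, ξ⟫).trans
    (mul_le_mul_of_nonneg_left (abs_real_inner_le_norm z ξ) (by positivity))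
  have h3 : 0 ≤ 2 * Real.pi * ‖ξ‖ := by positivity
  rcases le_total 1 ‖z‖ with h | h
  · rw [min_eq_left h]; linarith
  · rw [min_eq_right h]; nlinarith [norm_nonneg z]

theorem integrable_kernel_smul_diffSymbol {N : ℕ} (hN : 1 ≤ N) {a : ℝ} (ha : 0 < a) (ha1 : a < 1)
    (ξ : Space N) : Integrable (fun z : Space N => kernel a z • diffSymbol ⟪z, ξ⟫) := by
  refine ((integrable_min_one_mul_kernel hN ha ha1).const_mul (2 + 2 * Real.pi * ‖ξ‖)).mono'
    (by fun_prop) (ae_of_all _ fun z => ?_)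
  rw [norm_smul, Real.norm_of_nonneg (kernel_nonneg a z), ← mul_assoc, mul_comm]
  exact mul_le_mul_of_nonneg_right (norm_diffSymbol_inner_le z ξ) (kernel_nonneg a z)

theorem integrable_kernel_mul_norm_sq_diffSymbol {N : ℕ} (hN : 1 ≤ N) {a : ℝ} (ha : 0 < a)
    (ha2 : a < 2) (ξ : Space N) :
    Integrable (fun z : Space N => kernel a z * ‖diffSymbol ⟪z, ξ⟫‖ ^ 2) := by
  refine ((integrable_min_mul_kernel hN ha ha2).const_mul ((2 + 2 * Real.pi * ‖ξ‖) ^ 2)).mono'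
    (by fun_prop) (ae_of_all _ fun z => ?_)
  rw [norm_mul, Real.norm_of_nonneg (kernel_nonneg a z), Real.norm_of_nonneg (by positivity),
    ← mul_assoc, mul_comm]
  refine mul_le_mul_of_nonneg_right ?_ (kernel_nonneg a z)
  refine (pow_le_pow_left₀ (norm_nonneg _) (norm_diffSymbol_inner_le z ξ) 2).trans ?_
  rw [mul_pow]
  refine mul_le_mul_of_nonneg_left ?_ (by positivity)
  rw [Real.rpow_two]
  refine le_min ?_ ?_
  · exact pow_le_one₀ (by positivity) (min_le_left _ _)
  · exact pow_le_pow_left₀ (by positivity) (min_le_right _ _) 2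

theorem integral_kernel_mul_norm_sq_diffSymbol_pos {N : ℕ} (hN : 1 ≤ N) {a : ℝ} (ha : 0 < a)
    (ha2 : a < 2) {e : Space N} (he : ‖e‖ = 1) :
    0 < ∫ z : Space N, kernel a z * ‖diffSymbol ⟪z, e⟫‖ ^ 2 := by
  rw [integral_pos_iff_support_of_nonneg
    (fun z => mul_nonneg (kernel_nonneg a z) (by positivity))
    (integrable_kernel_mul_norm_sq_diffSymbol hN ha ha2 e)]
  have hopen : IsOpen {z : Space N | 0 < ⟪z, e⟫ ∧ ⟪z, e⟫ < 1} :=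
    (isOpen_Ioo (a := (0 : ℝ)) (b := 1)).preimage (f := fun z : Space N => ⟪z, e⟫) (by fun_prop)
  have hne : {z : Space N | 0 < ⟪z, e⟫ ∧ ⟪z, e⟫ < 1}.Nonempty := by
    refine ⟨(1 / 2 : ℝ) • e, ?_⟩
    simp only [mem_ofPred_eq, real_inner_smul_left, real_inner_self_eq_norm_sq, he]
    norm_num
  refine (hopen.measure_pos volume hne).trans_le (measure_mono fun z hz => ?_)
  have hz0 : z ≠ 0 := by rintro rfl; simp at hz
  have h1 : 0 < kernel a z := by
    have := norm_pos_iff.2 hz0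
    unfold kernel; positivity
  exact (mul_pos h1 (pow_pos (norm_diffSymbol_pos hz.1 hz.2) 2)).ne'

/-! ### The half Laplacian on test functions -/

namespace IsTest

variable {N : ℕ} {ψ η : Space N → ℝ}

theorem continuous (h : IsTest ψ) : Continuous ψ := h.1.continuous

theorem integrable (h : IsTest ψ) : Integrable ψ := h.continuous.integrable_of_hasCompactSupport h.2

theorem sub (h : IsTest ψ) (h' : IsTest η) : IsTest (fun x => ψ x - η x) := ⟨h.1.sub h'.1, by
  simpa [Function.comp_def] using! h.2.comp₂_left h'.2 (m := fun a b : ℝ => a - b) (by simp)⟩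

theorem const_mul (h : IsTest ψ) (c : ℝ) : IsTest (fun x => c * ψ x) :=
  ⟨contDiff_const.mul h.1, h.2.mul_left⟩

theorem comp_smul (h : IsTest ψ) {t : ℝ} (ht : t ≠ 0) : IsTest (fun x => ψ (t • x)) :=
  ⟨h.1.comp (contDiff_const_smul t), h.2.comp_homeomorph (Homeomorph.smulOfNeZero t ht)⟩

theorem comp_left (h : IsTest ψ) {p : ℝ → ℝ} (hp : ContDiff ℝ ∞ p) (hp0 : p 0 = 0) :
    IsTest (fun x => p (ψ x)) := ⟨hp.comp h.1, h.2.comp_left hp0⟩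

theorem integrable_sub_translate (h : IsTest ψ) (z : Space N) :
    Integrable (fun x => ψ x - ψ (x - z)) := h.integrable.sub (h.integrable.comp_sub_right z)

theorem exists_abs_sub_translate_le (h : IsTest ψ) :
    ∃ C, 0 ≤ C ∧ ∀ x z, |ψ x - ψ (x - z)| ≤ C * min 1 ‖z‖ := by
  obtain ⟨B, hB⟩ := h.2.exists_bound_of_continuous h.continuous
  obtain ⟨L, hL⟩ := (h.1.of_le (by simp)).lipschitzWith_of_hasCompactSupport h.2 one_ne_zero
  have hB0 : 0 ≤ B := (norm_nonneg _).trans (hB 0)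
  refine ⟨2 * B + L, by positivity, fun x z => ?_⟩
  have h1 : |ψ x - ψ (x - z)| ≤ L * ‖z‖ := by
    simpa [Real.dist_eq, dist_eq_norm] using hL.dist_le_mul x (x - z)
  have h2 : |ψ x - ψ (x - z)| ≤ 2 * B := by
    have := norm_sub_le (ψ x) (ψ (x - z))
    rw [Real.norm_eq_abs] at this
    linarith [hB x, hB (x - z)]
  have h3 : (0 : ℝ) ≤ L := L.2
  rcases le_total 1 ‖z‖ with hz | hz
  · rw [min_eq_left hz]; linarith
  · rw [min_eq_right hz]; nlinarith [norm_nonneg z]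

/-- For `‖z‖ ≤ 1` the difference lives on the closed unit neighbourhood of the support, which is
compact, and is pointwise of size `‖z‖`; for larger `z` the triangle inequality in `L¹` suffices. -/
theorem exists_integral_abs_sub_translate_le (h : IsTest ψ) :
    ∃ C, 0 ≤ C ∧ ∀ z, ∫ x, |ψ x - ψ (x - z)| ≤ C * min 1 ‖z‖ := by
  obtain ⟨B, hB0, hB⟩ := h.exists_abs_sub_translate_le
  set K := Metric.cthickening 1 (tsupport ψ)
  have hK : IsCompact K := IsCompact.cthickening h.2
  have hKm : MeasurableSet K := hK.measurableSet
  refine ⟨B * volume.real K + 2 * ∫ x, |ψ x|, by positivity, fun z => ?_⟩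
  have hI : 0 ≤ ∫ x, |ψ x| := by positivity
  have hv : 0 ≤ B * volume.real K := by positivity
  rcases le_total 1 ‖z‖ with hz | hz
  · rw [min_eq_left hz, mul_one]
    have h1 : ∫ x, |ψ x - ψ (x - z)| ≤ ∫ x, (|ψ x| + |ψ (x - z)|) :=
      integral_mono (h.integrable_sub_translate z).abs
        (h.integrable.abs.add (h.integrable.abs.comp_sub_right z)) fun x => abs_sub _ _
    rw [integral_add h.integrable.abs (h.integrable.abs.comp_sub_right z),
      integral_sub_right_eq_self (fun x => |ψ x|) z] at h1
    linarith
  · rw [min_eq_right hz]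
    have h0 : ∀ x ∉ K, |ψ x - ψ (x - z)| = 0 := by
      intro x hx
      have h1 : x ∉ tsupport ψ := fun hx' => hx (Metric.self_subset_cthickening _ hx')
      have h2 : x - z ∉ tsupport ψ := fun hx' => hx
        (Metric.mem_cthickening_of_dist_le x (x - z) 1 _ hx' (by simpa [dist_eq_norm] using hz))
      rw [image_eq_zero_of_notMem_tsupport h1, image_eq_zero_of_notMem_tsupport h2]
      simp
    rw [← setIntegral_eq_integral_of_forall_compl_eq_zero h0]
    have h1 : ∫ x in K, |ψ x - ψ (x - z)| ≤ ∫ _ in K, B * ‖z‖ :=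
      setIntegral_mono (h.integrable_sub_translate z).abs.integrableOn
        (integrableOn_const hK.measure_lt_top.ne)
        fun x => (hB x z).trans (mul_le_mul_of_nonneg_left (min_le_right _ _) hB0)
    rw [setIntegral_const, smul_eq_mul] at h1
    nlinarith [mul_nonneg hI (norm_nonneg z)]

theorem integrable_prod (hN : 1 ≤ N) (h : IsTest ψ) {a : ℝ} (ha : 0 < a) (ha1 : a < 1) :
    Integrable (fun q : Space N × Space N => kernel a q.2 * (ψ q.1 - ψ (q.1 - q.2)))
      (volume.prod volume) := by
  obtain ⟨C, hC0, hC⟩ := h.exists_integral_abs_sub_translate_le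
  have hc := h.continuous
  have hm : Measurable (fun q : Space N × Space N => kernel a q.2 * (ψ q.1 - ψ (q.1 - q.2))) := by
    have h1 : Continuous (fun q : Space N × Space N => ψ q.1 - ψ (q.1 - q.2)) := by fun_prop
    exact ((measurable_kernel a).comp measurable_snd).mul h1.measurable
  refine (integrable_prod_iff' hm.aestronglyMeasurable).2 ⟨ae_of_all _ fun z =>
    (h.integrable_sub_translate z).const_mul (kernel a z), ?_⟩
  refine ((integrable_min_one_mul_kernel hN ha ha1).const_mul C).mono'
    hm.aestronglyMeasurable.norm.prod_swap.integral_prod_right' (ae_of_all _ fun z => ?_)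
  rw [Real.norm_of_nonneg (by positivity)]
  simp only [norm_mul, Real.norm_of_nonneg (kernel_nonneg a z)]
  rw [integral_const_mul, ← mul_assoc, mul_comm]
  exact mul_le_mul_of_nonneg_right (hC z) (kernel_nonneg a z)

end IsTest

/-- The unnormalised operator `ψ ↦ ∫ (ψ x - ψ (x - z)) ‖z‖^{-(N+a)} dz`. -/
def diffOp {N : ℕ} (a : ℝ) (ψ : Space N → ℝ) (x : Space N) : ℝ :=
  ∫ z, kernel a z * (ψ x - ψ (x - z))

namespace IsTest

variable {N : ℕ} {ψ η : Space N → ℝ} {a : ℝ}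

theorem integrable_kernel_mul (hN : 1 ≤ N) (h : IsTest ψ) (ha : 0 < a) (ha1 : a < 1)
    (x : Space N) : Integrable (fun z => kernel a z * (ψ x - ψ (x - z))) := by
  obtain ⟨C, hC0, hC⟩ := h.exists_abs_sub_translate_le
  have hc := h.continuous
  have hm : Measurable (fun z => ψ x - ψ (x - z)) :=
    Continuous.measurable (by fun_prop)
  refine ((integrable_min_one_mul_kernel hN ha ha1).const_mul C).mono'
    ((measurable_kernel a).mul hm).aestronglyMeasurable (ae_of_all _ fun z => ?_)
  rw [norm_mul, Real.norm_of_nonneg (kernel_nonneg a z), ← mul_assoc, mul_comm]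
  exact mul_le_mul_of_nonneg_right (hC x z) (kernel_nonneg a z)

theorem continuous_diffOp (hN : 1 ≤ N) (h : IsTest ψ) (ha : 0 < a) (ha1 : a < 1) :
    Continuous (diffOp a ψ) := by
  obtain ⟨C, hC0, hC⟩ := h.exists_abs_sub_translate_le
  have hc := h.continuous
  refine continuous_of_dominated (fun x => (h.integrable_kernel_mul hN ha ha1 x).1)
    (fun x => ae_of_all _ fun z => ?_) ((integrable_min_one_mul_kernel hN ha ha1).const_mul C)
    (ae_of_all _ fun z => by fun_prop)
  rw [norm_mul, Real.norm_of_nonneg (kernel_nonneg a z), ← mul_assoc, mul_comm]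
  exact mul_le_mul_of_nonneg_right (hC x z) (kernel_nonneg a z)

theorem integrable_diffOp (hN : 1 ≤ N) (h : IsTest ψ) (ha : 0 < a) (ha1 : a < 1) :
    Integrable (diffOp a ψ) := (h.integrable_prod hN ha ha1).integral_prod_left

theorem exists_abs_diffOp_le (hN : 1 ≤ N) (h : IsTest ψ) (ha : 0 < a) (ha1 : a < 1) :
    ∃ B, ∀ x, |diffOp a ψ x| ≤ B := by
  obtain ⟨C, hC0, hC⟩ := h.exists_abs_sub_translate_le
  refine ⟨∫ z : Space N, C * (min 1 ‖z‖ * kernel a z), fun x => ?_⟩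
  rw [diffOp, ← Real.norm_eq_abs]
  refine norm_integral_le_of_norm_le ((integrable_min_one_mul_kernel hN ha ha1).const_mul C)
    (ae_of_all _ fun z => ?_)
  rw [norm_mul, Real.norm_of_nonneg (kernel_nonneg a z), ← mul_assoc, mul_comm]
  exact mul_le_mul_of_nonneg_right (hC x z) (kernel_nonneg a z)

/-- Since the order `a` is below one, the Lipschitz bound makes the integral absolutely convergent,
so the principal value is an ordinary integral by dominated convergence. -/
theorem fracLap_eq (hN : 1 ≤ N) (h : IsTest ψ) (ha : 0 < a) (ha1 : a < 1) (x : Space N) :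
    fracLap (a / 2) ψ x = fracConst N (a / 2) * diffOp a ψ x := by
  unfold fracLap
  congr 1
  refine Tendsto.limUnder_eq ?_
  set F : Space N → ℝ := fun y => (ψ x - ψ y) / ‖x - y‖ ^ ((N : ℝ) + 2 * (a / 2))
  have hF : ∀ z, F (x - z) = kernel a z * (ψ x - ψ (x - z)) := by
    intro z
    simp only [F, kernel, sub_sub_cancel, div_eq_mul_inv]
    rw [show 2 * (a * 2⁻¹) = a by ring, mul_comm]
  have hd : diffOp a ψ x = ∫ y, F y := by
    rw [← integral_sub_left_eq_self F volume x]
    simp only [hF, diffOp]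
  have hFi : Integrable F := by
    have := (h.integrable_kernel_mul hN ha ha1 x).comp_sub_left x
    refine this.congr (ae_of_all _ fun y => ?_)
    have := hF (x - y)
    rw [sub_sub_cancel] at this
    simp only [this, sub_sub_cancel]
  rw [hd]
  simp only [← integral_indicator (Metric.isOpen_ball.measurableSet.compl)]
  refine tendsto_integral_filter_of_dominated_convergence (fun y => ‖F y‖)
    (Eventually.of_forall fun r => (hFi.indicator Metric.isOpen_ball.measurableSet.compl).1)
    (Eventually.of_forall fun r => ae_of_all _ fun y => norm_indicator_le_norm_self _ _) hFi.norm
    (ae_of_all _ fun y => ?_)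
  rcases eq_or_ne y x with rfl | hy
  · have : F y = 0 := by simp [F]
    refine tendsto_const_nhds.congr fun r => ?_
    by_cases hr : y ∈ (Metric.ball y r)ᶜ
    · rw [indicator_of_mem hr]
    · rw [indicator_of_notMem hr, this]
  · refine tendsto_const_nhds.congr' ?_
    filter_upwards [nhdsWithin_le_nhds (Iio_mem_nhds (dist_pos.2 hy))] with r hr
    rw [indicator_of_mem]
    simpa using! (show r < dist y x from hr).le

theorem continuous_fracLap (hN : 1 ≤ N) (h : IsTest ψ) (ha : 0 < a) (ha1 : a < 1) :
    Continuous (fracLap (a / 2) ψ) := by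
  rw [funext (h.fracLap_eq hN ha ha1)]
  exact continuous_const.mul (h.continuous_diffOp hN ha ha1)

theorem integrable_fracLap (hN : 1 ≤ N) (h : IsTest ψ) (ha : 0 < a) (ha1 : a < 1) :
    Integrable (fracLap (a / 2) ψ) := by
  rw [funext (h.fracLap_eq hN ha ha1)]
  exact (h.integrable_diffOp hN ha ha1).const_mul _

theorem exists_abs_fracLap_le (hN : 1 ≤ N) (h : IsTest ψ) (ha : 0 < a) (ha1 : a < 1) :
    ∃ B, 0 ≤ B ∧ ∀ x, |fracLap (a / 2) ψ x| ≤ B := by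
  obtain ⟨B, hB⟩ := h.exists_abs_diffOp_le hN ha ha1
  have hle : ∀ x, |fracLap (a / 2) ψ x| ≤ |fracConst N (a / 2)| * B := by
    intro x
    rw [h.fracLap_eq hN ha ha1, abs_mul]
    exact mul_le_mul_of_nonneg_left (hB x) (abs_nonneg _)
  exact ⟨_, (abs_nonneg _).trans (hle 0), hle⟩

theorem memLp_fracLap (hN : 1 ≤ N) (h : IsTest ψ) (ha : 0 < a) (ha1 : a < 1) :
    MemLp (fracLap (a / 2) ψ) 2 := by
  obtain ⟨B, -, hB⟩ := h.exists_abs_fracLap_le hN ha ha1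
  have hi := h.integrable_fracLap hN ha ha1
  rw [memLp_two_iff_integrable_sq hi.1]
  simp only [sq]
  exact hi.bdd_mul hi.1 (ae_of_all _ hB)

theorem fracLap_sub (hN : 1 ≤ N) (h : IsTest ψ) (h' : IsTest η) (ha : 0 < a) (ha1 : a < 1)
    (x : Space N) : fracLap (a / 2) (fun x => ψ x - η x) x
      = fracLap (a / 2) ψ x - fracLap (a / 2) η x := by
  rw [h.fracLap_eq hN ha ha1, h'.fracLap_eq hN ha ha1, (h.sub h').fracLap_eq hN ha ha1,
    ← mul_sub]
  simp only [diffOp]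
  rw [← integral_sub (h.integrable_kernel_mul hN ha ha1 x) (h'.integrable_kernel_mul hN ha ha1 x)]
  congr 2; ext z; ring

theorem fracLap_const_mul (hN : 1 ≤ N) (h : IsTest ψ) (c : ℝ) (ha : 0 < a) (ha1 : a < 1)
    (x : Space N) : fracLap (a / 2) (fun x => c * ψ x) x = c * fracLap (a / 2) ψ x := by
  rw [h.fracLap_eq hN ha ha1, (h.const_mul c).fracLap_eq hN ha ha1, mul_left_comm]
  congr 1
  simp only [diffOp]
  rw [← integral_const_mul]
  refine integral_congr_ae (ae_of_all _ fun z => ?_)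
  ring

theorem fracLap_comp_smul (hN : 1 ≤ N) (h : IsTest ψ) {t : ℝ} (ht : 0 < t) (ha : 0 < a)
    (ha1 : a < 1) (x : Space N) :
    fracLap (a / 2) (fun x => ψ (t • x)) x = t ^ a * fracLap (a / 2) ψ (t • x) := by
  rw [h.fracLap_eq hN ha ha1, (h.comp_smul ht.ne').fracLap_eq hN ha ha1, mul_left_comm]
  congr 1
  have hsc := Measure.integral_comp_smul (volume : Measure (Space N))
    (fun z => kernel a z * (ψ (t • x) - ψ (t • x - z))) t
  rw [finrank_euclideanSpace_fin, abs_of_pos (by positivity)] at hsc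
  have h2 : ∀ z : Space N, kernel a (t • z) * (ψ (t • x) - ψ (t • x - t • z))
      = ((t ^ N)⁻¹ * t ^ (-a)) * (kernel a z * (ψ (t • x) - ψ (t • (x - z)))) := by
    intro z
    rw [kernel_smul a ht, smul_sub]; ring
  simp only [h2] at hsc
  rw [integral_const_mul, smul_eq_mul, mul_assoc] at hsc
  have h3 := mul_left_cancel₀ (inv_ne_zero (pow_ne_zero N ht.ne')) hsc
  simp only [diffOp]
  rw [← h3, ← mul_assoc, ← Real.rpow_add ht, add_neg_cancel, Real.rpow_zero, one_mul]

end IsTest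

theorem fracConst_pos {N : ℕ} {σ : ℝ} (h0 : 0 < σ) (h1 : σ < 1) : 0 < fracConst N σ := by
  have hg1 : 0 < Real.Gamma ((N : ℝ) / 2 + σ) := Real.Gamma_pos_of_pos (by positivity)
  have hg2 : 0 < Real.Gamma (1 - σ) := Real.Gamma_pos_of_pos (by linarith)
  have := Real.pi_pos
  unfold fracConst; positivity

/-! ### `L²` norms -/

/-- The `L²` norm as a real number. -/
def norm2 {N : ℕ} (g : Space N → ℝ) : ℝ := (eLpNorm g 2 volume).toReal

theorem norm2_nonneg {N : ℕ} (g : Space N → ℝ) : 0 ≤ norm2 g := ENNReal.toReal_nonneg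

theorem norm2_sq {N : ℕ} {g : Space N → ℝ} (hg : MemLp g 2) : norm2 g ^ 2 = ∫ x, g x * g x := by
  have h1 : norm2 g = ‖hg.toLp g‖ := (Lp.norm_toLp g hg).symm
  rw [h1, ← real_inner_self_eq_norm_sq, L2.inner_def]
  refine integral_congr_ae ?_
  filter_upwards [hg.coeFn_toLp] with x hx
  rw [hx]; simp [sq]

theorem integrable_mul_of_memLp_two {N : ℕ} {f g : Space N → ℝ} (hf : MemLp f 2)
    (hg : MemLp g 2) : Integrable (fun x => f x * g x) := hf.integrable_mul hg

theorem abs_integral_mul_le {N : ℕ} {f g : Space N → ℝ} (hf : MemLp f 2) (hg : MemLp g 2) :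
    |∫ x, f x * g x| ≤ norm2 f * norm2 g := by
  have h1 : norm2 f = ‖hf.toLp f‖ := (Lp.norm_toLp f hf).symm
  have h2 : norm2 g = ‖hg.toLp g‖ := (Lp.norm_toLp g hg).symm
  have h3 : ∫ x, f x * g x = ⟪hf.toLp f, hg.toLp g⟫ := by
    rw [L2.inner_def]
    refine integral_congr_ae ?_
    filter_upwards [hf.coeFn_toLp, hg.coeFn_toLp] with x hx hx'
    rw [hx, hx']; simp [mul_comm]
  rw [h1, h2, h3]
  exact abs_real_inner_le_norm _ _

/-! ### Fourier transform of real-valued functions -/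

/-- The Fourier transform of a real-valued function. -/
def ft {N : ℕ} (ψ : Space N → ℝ) : Space N → ℂ := 𝓕 (fun x => (ψ x : ℂ))

theorem ft_apply {N : ℕ} (ψ : Space N → ℝ) (ξ : Space N) :
    ft ψ ξ = ∫ x, 𝐞 (-⟪x, ξ⟫) • (ψ x : ℂ) := Real.fourier_eq _ _

/-- Parseval's identity in `L¹` form: write `g` as the inverse transform of `ft g` and move the
transform onto `f` by Fubini. Only `g` has to satisfy Fourier inversion. -/
theorem ofReal_integral_mul_eq_integral_ft {N : ℕ} {f g : Space N → ℝ} (hf : Integrable f)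
    (hg : Integrable g) (hgc : Continuous g) (hg' : Integrable (ft g)) :
    ((∫ x, f x * g x : ℝ) : ℂ) = ∫ ξ, conj (ft f ξ) * ft g ξ := by
  have hgc' : Continuous fun x => (g x : ℂ) := by fun_prop
  have h := VectorFourier.integral_sesq_fourierIntegral_eq_neg_flip (innerSL ℂ)
    (L := innerₗ (Space N)) Real.continuous_fourierChar continuous_inner hf.ofReal hg'
    (μ := volume) (ν := volume) (f := fun x => (f x : ℂ))
  have hinv : ∀ x, VectorFourier.fourierIntegral 𝐞 volume (-(innerₗ (Space N)).flip) (ft g) x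
      = (g x : ℂ) := by
    intro x
    have h1 := congrFun (hgc'.fourierInv_fourier_eq hg.ofReal hg') x
    rw [← h1]
    simp only [flip_innerₗ]
    rfl
  simp only [hinv, innerSL_apply_apply, RCLike.inner_apply'] at h
  rw [← integral_complex_ofReal]
  refine Eq.trans ?_ h.symm
  simp

theorem exists_norm_ft_le {N : ℕ} (ψ : Space N → ℝ) : ∃ B, 0 ≤ B ∧ ∀ ξ, ‖ft ψ ξ‖ ≤ B := by
  refine ⟨∫ x, ‖(ψ x : ℂ)‖, by positivity, fun ξ => ?_⟩
  rw [ft_apply]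
  refine (norm_integral_le_integral_norm _).trans ?_
  simp

namespace IsTest

variable {N : ℕ} {ψ η : Space N → ℝ} {a : ℝ}

theorem exists_schwartz (h : IsTest ψ) : ∃ S : SchwartzMap (Space N) ℂ, ∀ ξ, S ξ = ft ψ ξ := by
  have h1 : HasCompactSupport (fun x => (ψ x : ℂ)) := h.2.comp_left (g := fun t : ℝ => (t : ℂ)) rfl
  have h2 : ContDiff ℝ ∞ (fun x => (ψ x : ℂ)) := Complex.ofRealCLM.contDiff.comp h.1
  refine ⟨𝓕 (h1.toSchwartzMap h2), fun ξ => ?_⟩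
  rw [SchwartzMap.fourier_coe]
  rfl

theorem continuous_ft (h : IsTest ψ) : Continuous (ft ψ) := by
  obtain ⟨S, hS⟩ := h.exists_schwartz
  rw [← funext hS]; exact S.continuous

theorem integrable_pow_mul_ft (h : IsTest ψ) (k : ℕ) :
    Integrable (fun ξ => ‖ξ‖ ^ k * ‖ft ψ ξ‖) := by
  obtain ⟨S, hS⟩ := h.exists_schwartz
  simp only [← hS]
  exact S.integrable_pow_mul volume k

theorem integrable_ft (h : IsTest ψ) : Integrable (ft ψ) := by
  obtain ⟨S, hS⟩ := h.exists_schwartz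
  rw [← funext hS]; exact S.integrable

theorem integrable_rpow_mul_ft (h : IsTest ψ) (ha : 0 < a) (ha2 : a < 2) :
    Integrable (fun ξ => ‖ξ‖ ^ a * ‖ft ψ ξ‖) := by
  have hc := h.continuous_ft
  refine ((h.integrable_pow_mul_ft 0).add (h.integrable_pow_mul_ft 2)).mono'
    (Measurable.aestronglyMeasurable (by fun_prop)) (ae_of_all _ fun ξ => ?_)
  rw [Real.norm_of_nonneg (by positivity)]
  simp only [Pi.add_apply]
  rw [← add_mul]
  refine mul_le_mul_of_nonneg_right ?_ (norm_nonneg _)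
  rcases le_total ‖ξ‖ 1 with hξ | hξ
  · have := Real.rpow_le_one (norm_nonneg ξ) hξ ha.le
    nlinarith [sq_nonneg ‖ξ‖]
  · have := Real.rpow_le_rpow_of_exponent_le hξ ha2.le
    rw [Real.rpow_two] at this
    nlinarith

theorem ft_sub_translate (h : IsTest ψ) (z ξ : Space N) :
    ft (fun x => ψ x - ψ (x - z)) ξ = diffSymbol ⟪z, ξ⟫ * ft ψ ξ := by
  have hi1 : Integrable (fun x => 𝐞 (-⟪x, ξ⟫) • (ψ x : ℂ)) :=
    (Real.fourierIntegral_convergent_iff ξ).2 h.integrable.ofReal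
  have hi2 : Integrable (fun x => 𝐞 (-⟪x, ξ⟫) • (ψ (x - z) : ℂ)) :=
    (Real.fourierIntegral_convergent_iff ξ).2 (h.integrable.comp_sub_right z).ofReal
  have h2 : ∫ x, 𝐞 (-⟪x, ξ⟫) • (ψ (x - z) : ℂ) = (𝐞 (-⟪z, ξ⟫) : ℂ) * ft ψ ξ := by
    rw [ft_apply, ← integral_const_mul,
      ← integral_sub_right_eq_self (fun x => (𝐞 (-⟪z, ξ⟫) : ℂ) * 𝐞 (-⟪x, ξ⟫) • (ψ x : ℂ)) z]
    refine integral_congr_ae (ae_of_all _ fun x => ?_)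
    simp only [Circle.smul_def, smul_eq_mul]
    rw [← mul_assoc, ← Circle.coe_mul, ← AddChar.map_add_eq_mul, inner_sub_left]
    congr 3; ring_nf
  rw [ft_apply]
  simp only [Complex.ofReal_sub, smul_sub]
  rw [integral_sub hi1 hi2, h2, ← ft_apply, diffSymbol]
  ring

/-- Fubini, each translated difference contributing the factor `diffSymbol ⟪z, ξ⟫`. -/
theorem ft_diffOp (hN : 1 ≤ N) (h : IsTest ψ) (ha : 0 < a) (ha1 : a < 1) (ξ : Space N) :
    ft (diffOp a ψ) ξ = (∫ z : Space N, kernel a z • diffSymbol ⟪z, ξ⟫) * ft ψ ξ := by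
  have hprod : Integrable (fun q : Space N × Space N =>
      𝐞 (-⟪q.1, ξ⟫) • ((kernel a q.2 * (ψ q.1 - ψ (q.1 - q.2)) : ℝ) : ℂ))
      (volume.prod volume) := by
    refine (h.integrable_prod hN ha ha1).mono ?_ (ae_of_all _ fun q => by
      rw [Circle.norm_smul, Complex.norm_real])
    have hc : Continuous (fun q : Space N × Space N => (𝐞 (-⟪q.1, ξ⟫) : ℂ)) := by
      have := Real.continuous_fourierChar
      fun_prop
    exact hc.aestronglyMeasurable.mul (h.integrable_prod hN ha ha1).ofReal.1
  rw [ft_apply]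
  have h1 : ∀ x, 𝐞 (-⟪x, ξ⟫) • (diffOp a ψ x : ℂ)
      = ∫ z, 𝐞 (-⟪x, ξ⟫) • ((kernel a z * (ψ x - ψ (x - z)) : ℝ) : ℂ) := by
    intro x
    simp only [diffOp, Circle.smul_def]
    rw [integral_smul, integral_complex_ofReal]
  simp only [h1]
  rw [integral_integral_swap hprod, ← integral_mul_const]
  refine integral_congr_ae (ae_of_all _ fun z => ?_)
  simp only
  rw [smul_mul_assoc, ← h.ft_sub_translate, ft_apply, ← integral_smul]
  refine integral_congr_ae (ae_of_all _ fun x => ?_)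
  simp only [Circle.smul_def, Complex.real_smul, smul_eq_mul]
  push_cast; ring

end IsTest

/-- A fixed unit vector. -/
def unitVec {N : ℕ} (hN : 1 ≤ N) : Space N := EuclideanSpace.single ⟨0, hN⟩ 1

theorem norm_unitVec {N : ℕ} (hN : 1 ≤ N) : ‖unitVec hN‖ = 1 := by simp [unitVec]

/-- The constant in the Fourier symbol of the normalised half Laplacian. -/
def symbolConst {N : ℕ} (hN : 1 ≤ N) (a : ℝ) : ℂ :=
  fracConst N (a / 2) * ∫ z : Space N, kernel a z • diffSymbol ⟪z, unitVec hN⟫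

/-- The exact value of the constant is never needed. Its nonvanishing allows `‖ξ‖^a ft ψ` to be
controlled by the energy. -/
theorem symbolConst_ne_zero {N : ℕ} (hN : 1 ≤ N) {a : ℝ} (ha : 0 < a) (ha1 : a < 1) :
    symbolConst hN a ≠ 0 := by
  refine mul_ne_zero ?_ fun h0 => ?_
  · exact_mod_cast (fracConst_pos (by linarith) (by linarith)).ne'
  have h1 := integral_kernel_mul_norm_sq_diffSymbol_pos hN ha (by linarith) (norm_unitVec hN)
  have h2 : (∫ z : Space N, kernel a z • diffSymbol ⟪z, unitVec hN⟫).re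
      = ∫ z : Space N, (kernel a z • diffSymbol ⟪z, unitVec hN⟫).re :=
    (integral_re (integrable_kernel_smul_diffSymbol hN ha ha1 _)).symm
  have h3 : ∫ z : Space N, kernel a z * ‖diffSymbol ⟪z, unitVec hN⟫‖ ^ 2
      = 2 * ∫ z : Space N, (kernel a z • diffSymbol ⟪z, unitVec hN⟫).re := by
    rw [← integral_const_mul]
    refine integral_congr_ae (ae_of_all _ fun z => ?_)
    simp only [norm_sq_diffSymbol, Complex.smul_re, smul_eq_mul]; ring
  rw [h3, ← h2, h0] at h1
  simp at h1

/-! ### The energy in Fourier variables and as a double integral -/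

namespace IsTest

variable {N : ℕ} {ψ η : Space N → ℝ} {a : ℝ}

theorem ft_fracLap (hN : 1 ≤ N) (h : IsTest ψ) (ha : 0 < a) (ha1 : a < 1) (ξ : Space N) :
    ft (fracLap (a / 2) ψ) ξ = symbolConst hN a * (‖ξ‖ ^ a : ℝ) * ft ψ ξ := by
  have h1 : ft (fracLap (a / 2) ψ) ξ = fracConst N (a / 2) * ft (diffOp a ψ) ξ := by
    rw [funext (h.fracLap_eq hN ha ha1), ft_apply, ft_apply, ← integral_const_mul]
    refine integral_congr_ae (ae_of_all _ fun x => ?_)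
    simp only [Circle.smul_def, smul_eq_mul]
    push_cast; ring
  rw [h1, h.ft_diffOp hN ha ha1, symbolConst,
    integral_kernel_smul_comp_inner ha diffSymbol diffSymbol_zero (norm_unitVec hN) ξ,
    Complex.real_smul]
  ring

theorem integrable_ft_fracLap (hN : 1 ≤ N) (h : IsTest ψ) (ha : 0 < a) (ha1 : a < 1) :
    Integrable (ft (fracLap (a / 2) ψ)) := by
  have hc := h.continuous_ft
  rw [funext (h.ft_fracLap hN ha ha1)]
  refine ((h.integrable_rpow_mul_ft ha (by linarith)).const_mul ‖symbolConst hN a‖).mono'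
    (Measurable.aestronglyMeasurable (by fun_prop)) (ae_of_all _ fun ξ => ?_)
  rw [norm_mul, norm_mul, Complex.norm_real, Real.norm_of_nonneg (by positivity), mul_assoc]

/-- The energy of two test functions in Fourier variables. -/
theorem ofReal_integral_fracLap_mul (hN : 1 ≤ N) (h : IsTest ψ) (h' : IsTest η) (ha : 0 < a)
    (ha1 : a < 1) :
    ((∫ x, fracLap (a / 2) ψ x * fracLap (a / 2) η x : ℝ) : ℂ)
      = (‖symbolConst hN a‖ ^ 2 : ℝ) *
        ∫ ξ, (‖ξ‖ ^ (2 * a) : ℝ) * (conj (ft ψ ξ) * ft η ξ) := by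
  rw [ofReal_integral_mul_eq_integral_ft (h.integrable_fracLap hN ha ha1)
    (h'.integrable_fracLap hN ha ha1) (h'.continuous_fracLap hN ha ha1)
    (h'.integrable_ft_fracLap hN ha ha1), ← integral_const_mul]
  refine integral_congr_ae (ae_of_all _ fun ξ => ?_)
  simp only [h.ft_fracLap hN ha ha1, h'.ft_fracLap hN ha ha1, map_mul, Complex.conj_ofReal]
  rw [two_mul, Real.rpow_add_of_nonneg (norm_nonneg _) ha.le ha.le]
  push_cast
  rw [← Complex.conj_mul']
  ring

theorem ofReal_integral_sub_translate_mul (h : IsTest ψ) (h' : IsTest η) (z : Space N) :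
    ((∫ x, (ψ x - ψ (x - z)) * (η x - η (x - z)) : ℝ) : ℂ)
      = ∫ ξ, (‖diffSymbol ⟪z, ξ⟫‖ ^ 2 : ℝ) * (conj (ft ψ ξ) * ft η ξ) := by
  have hc := h'.continuous
  have hi : Integrable (ft (fun x => η x - η (x - z))) := by
    have hc' := h'.continuous_ft
    rw [funext (h'.ft_sub_translate z)]
    refine h'.integrable_ft.bdd_mul (c := 2) (Continuous.aestronglyMeasurable (by fun_prop))
      (ae_of_all _ fun ξ => norm_diffSymbol_le_two _)
  rw [ofReal_integral_mul_eq_integral_ft (h.integrable_sub_translate z)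
    (h'.integrable_sub_translate z) (by fun_prop) hi]
  refine integral_congr_ae (ae_of_all _ fun ξ => ?_)
  simp only [h.ft_sub_translate, h'.ft_sub_translate, map_mul]
  push_cast
  rw [← Complex.conj_mul']
  ring

/-- The energy of two test functions as a double integral of products of differences. -/
theorem exists_integral_fracLap_mul_eq (hN : 1 ≤ N) (ha : 0 < a) (ha1 : a < 1) :
    ∃ c, 0 ≤ c ∧ ∀ ψ η : Space N → ℝ, IsTest ψ → IsTest η →
      ∫ x, fracLap (a / 2) ψ x * fracLap (a / 2) η x
        = c * ∫ z, kernel (2 * a) z * ∫ x, (ψ x - ψ (x - z)) * (η x - η (x - z)) := by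
  set D := ∫ z : Space N, kernel (2 * a) z * ‖diffSymbol ⟪z, unitVec hN⟫‖ ^ 2 with hD
  have hDpos : 0 < D := integral_kernel_mul_norm_sq_diffSymbol_pos hN (by linarith) (by linarith)
    (norm_unitVec hN)
  refine ⟨‖symbolConst hN a‖ ^ 2 / D, by positivity, fun ψ η h h' => ?_⟩
  -- The squared difference symbol integrates to a multiple of `‖ξ‖^(2a)`, the same power as in the
  -- Fourier form of the energy; the two forms then differ only by a constant.
  have hmul : ∀ ξ : Space N, ∫ z : Space N, kernel (2 * a) z * ‖diffSymbol ⟪z, ξ⟫‖ ^ 2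
      = ‖ξ‖ ^ (2 * a) * D := fun ξ =>
    integral_kernel_smul_comp_inner (by linarith) (fun t => ‖diffSymbol t‖ ^ 2)
      (by simp [diffSymbol_zero]) (norm_unitVec hN) ξ
  obtain ⟨B, hB0, hB⟩ := exists_norm_ft_le ψ
  have hc := h.continuous_ft
  have hc' := h'.continuous_ft
  set ρ : Space N → ℂ := fun ξ => conj (ft ψ ξ) * ft η ξ with hρ
  have hρc : Continuous ρ := by fun_prop
  have hρn : ∀ ξ, ‖ρ ξ‖ ≤ B * ‖ft η ξ‖ := fun ξ => by
    rw [hρ, norm_mul, RCLike.norm_conj]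
    exact mul_le_mul_of_nonneg_right (hB ξ) (norm_nonneg _)
  have hprod : Integrable (fun q : Space N × Space N =>
      ((kernel (2 * a) q.1 * ‖diffSymbol ⟪q.1, q.2⟫‖ ^ 2 : ℝ) : ℂ) * ρ q.2)
      (volume.prod volume) := by
    have hm : Measurable (fun q : Space N × Space N =>
        ((kernel (2 * a) q.1 * ‖diffSymbol ⟪q.1, q.2⟫‖ ^ 2 : ℝ) : ℂ) * ρ q.2) := by
      have h1 : Continuous (fun q : Space N × Space N => ‖diffSymbol ⟪q.1, q.2⟫‖ ^ 2) := by
        fun_prop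
      exact (Complex.measurable_ofReal.comp (((measurable_kernel _).comp measurable_fst).mul
        h1.measurable)).mul (hρc.measurable.comp measurable_snd)
    refine (integrable_prod_iff' hm.aestronglyMeasurable).2 ⟨ae_of_all _ fun ξ =>
      ((integrable_kernel_mul_norm_sq_diffSymbol hN (by linarith) (by linarith)
        ξ).ofReal).mul_const (ρ ξ), ?_⟩
    have hn : ∀ ξ : Space N, ∫ z : Space N,
        ‖((kernel (2 * a) z * ‖diffSymbol ⟪z, ξ⟫‖ ^ 2 : ℝ) : ℂ) * ρ ξ‖
        = ‖ξ‖ ^ (2 * a) * D * ‖ρ ξ‖ := by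
      intro ξ
      rw [← hmul, ← integral_mul_const]
      refine integral_congr_ae (ae_of_all _ fun z => ?_)
      simp only
      rw [norm_mul, Complex.norm_real,
        Real.norm_of_nonneg (mul_nonneg (kernel_nonneg _ _) (by positivity))]
    simp only [hn]
    refine ((h'.integrable_rpow_mul_ft (a := 2 * a) (by linarith) (by linarith)).const_mul
      (D * B)).mono' (Measurable.aestronglyMeasurable (by fun_prop)) (ae_of_all _ fun ξ => ?_)
    rw [Real.norm_of_nonneg (by positivity)]
    calc ‖ξ‖ ^ (2 * a) * D * ‖ρ ξ‖ ≤ ‖ξ‖ ^ (2 * a) * D * (B * ‖ft η ξ‖) :=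
          mul_le_mul_of_nonneg_left (hρn ξ) (by positivity)
      _ = _ := by ring
  have h2 : ((∫ z, kernel (2 * a) z * ∫ x, (ψ x - ψ (x - z)) * (η x - η (x - z)) : ℝ) : ℂ)
      = D * ∫ ξ, (‖ξ‖ ^ (2 * a) : ℝ) * ρ ξ := by
    rw [← integral_complex_ofReal]
    simp only [Complex.ofReal_mul (kernel (2 * a) _), h.ofReal_integral_sub_translate_mul h']
    simp only [← integral_const_mul]
    calc _ = ∫ z, ∫ ξ, ((kernel (2 * a) z * ‖diffSymbol ⟪z, ξ⟫‖ ^ 2 : ℝ) : ℂ) * ρ ξ := by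
          refine integral_congr_ae (ae_of_all _ fun z => integral_congr_ae (ae_of_all _ fun ξ => ?_))
          simp only [hρ]
          push_cast; ring
      _ = ∫ ξ, ∫ z, ((kernel (2 * a) z * ‖diffSymbol ⟪z, ξ⟫‖ ^ 2 : ℝ) : ℂ) * ρ ξ :=
          integral_integral_swap hprod
      _ = _ := by
          refine integral_congr_ae (ae_of_all _ fun ξ => ?_)
          simp only
          rw [integral_mul_const, integral_complex_ofReal, hmul]
          push_cast; ring
  apply Complex.ofReal_injective
  rw [Complex.ofReal_mul, h2, h.ofReal_integral_fracLap_mul hN h' ha ha1]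
  have : (D : ℂ) ≠ 0 := by exact_mod_cast hDpos.ne'
  rw [← mul_assoc]
  congr 1
  push_cast
  field_simp

/-! ### Energy of monotone compositions -/

theorem integral_fracLap_mul_nonneg (hN : 1 ≤ N) (h : IsTest ψ) (h' : IsTest η) (ha : 0 < a)
    (ha1 : a < 1) (hco : ∀ x y, 0 ≤ (ψ x - ψ y) * (η x - η y)) :
    0 ≤ ∫ x, fracLap (a / 2) ψ x * fracLap (a / 2) η x := by
  obtain ⟨c, hc, H⟩ := exists_integral_fracLap_mul_eq (N := N) hN ha ha1
  rw [H ψ η h h']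
  exact mul_nonneg hc (integral_nonneg fun z => mul_nonneg (kernel_nonneg _ _)
    (integral_nonneg fun x => hco _ _))

variable {p : ℝ → ℝ}

theorem integral_fracLap_mul_comp_nonneg (hN : 1 ≤ N) (h : IsTest ψ) (hp : ContDiff ℝ ∞ p)
    (hp0 : p 0 = 0) (hmono : Monotone p) (ha : 0 < a) (ha1 : a < 1) :
    0 ≤ ∫ x, fracLap (a / 2) ψ x * fracLap (a / 2) (fun x => p (ψ x)) x := by
  refine h.integral_fracLap_mul_nonneg hN (h.comp_left hp hp0) ha ha1 fun x y => ?_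
  rcases le_total (ψ x) (ψ y) with hxy | hxy
  · exact mul_nonneg_of_nonpos_of_nonpos (sub_nonpos.2 hxy) (sub_nonpos.2 (hmono hxy))
  · exact mul_nonneg (sub_nonneg.2 hxy) (sub_nonneg.2 (hmono hxy))

/-- Composition with a monotone Lipschitz function contracts the energy norm. -/
theorem norm2_fracLap_comp_le (hN : 1 ≤ N) (h : IsTest ψ) (hp : ContDiff ℝ ∞ p)
    (hp0 : p 0 = 0) (hmono : Monotone p) {L : ℝ} (hL : ∀ r t, r ≤ t → p t - p r ≤ L * (t - r))
    (ha : 0 < a) (ha1 : a < 1) :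
    norm2 (fracLap (a / 2) (fun x => p (ψ x))) ≤ L * norm2 (fracLap (a / 2) ψ) := by
  have hpψ := h.comp_left hp hp0
  have hT := h.memLp_fracLap hN ha ha1
  have hT' := hpψ.memLp_fracLap hN ha ha1
  have hL0 : 0 ≤ L := by
    have := hL 0 1 zero_le_one
    have h2 := hmono (zero_le_one' ℝ)
    linarith
  -- Both `p(ψ)` and `Lψ - p(ψ)` are nondecreasing functions of `ψ`, so their mutual energy is
  -- nonnegative; Cauchy-Schwarz then yields the contraction.
  have hd := (h.const_mul L).sub hpψ
  have h1 := hpψ.integral_fracLap_mul_nonneg hN hd ha ha1 (fun x y => by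
    rcases le_total (ψ x) (ψ y) with hxy | hxy
    · exact mul_nonneg_of_nonpos_of_nonpos (sub_nonpos.2 (hmono hxy))
        (by linarith [hL _ _ hxy])
    · exact mul_nonneg (sub_nonneg.2 (hmono hxy)) (by linarith [hL _ _ hxy]))
  have h2 : ∫ x, fracLap (a / 2) (fun x => p (ψ x)) x *
      fracLap (a / 2) (fun x => L * ψ x - p (ψ x)) x
      = L * (∫ x, fracLap (a / 2) (fun x => p (ψ x)) x * fracLap (a / 2) ψ x)
        - norm2 (fracLap (a / 2) (fun x => p (ψ x))) ^ 2 := by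
    rw [norm2_sq hT', ← integral_const_mul,
      ← integral_sub ((integrable_mul_of_memLp_two hT' hT).const_mul L)
        (integrable_mul_of_memLp_two hT' hT')]
    refine integral_congr_ae (ae_of_all _ fun x => ?_)
    simp only [(h.const_mul L).fracLap_sub hN hpψ ha ha1, h.fracLap_const_mul hN L ha ha1]
    ring
  rw [h2] at h1
  have h3 := (le_abs_self _).trans (abs_integral_mul_le hT' hT)
  have h4 : norm2 (fracLap (a / 2) (fun x => p (ψ x))) *
      norm2 (fracLap (a / 2) (fun x => p (ψ x)))
      ≤ norm2 (fracLap (a / 2) (fun x => p (ψ x))) * (L * norm2 (fracLap (a / 2) ψ)) := by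
    nlinarith [mul_le_mul_of_nonneg_left h3 hL0]
  rcases (norm2_nonneg (fracLap (a / 2) (fun x => p (ψ x)))).eq_or_lt with h0 | h0
  · rw [← h0]; exact mul_nonneg hL0 (norm2_nonneg _)
  · exact le_of_mul_le_mul_left h4 h0

end IsTest

/-! ### Smooth truncations -/

/-- A smooth, bounded, nondecreasing Lipschitz function. -/
structure IsTruncation (p : ℝ → ℝ) (L M : ℝ) : Prop where
  contDiff : ContDiff ℝ ∞ p
  mono : Monotone p
  lip : ∀ r t, r ≤ t → p t - p r ≤ L * (t - r)
  bound : ∀ t, |p t| ≤ M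

theorem IsTruncation.abs_sub_le {p : ℝ → ℝ} {L M : ℝ} (hp : IsTruncation p L M) (r t : ℝ) :
    |p t - p r| ≤ L * |t - r| := by
  rcases le_total r t with h | h
  · rw [abs_of_nonneg (sub_nonneg.2 (hp.mono h)), abs_of_nonneg (sub_nonneg.2 h)]
    exact hp.lip r t h
  · rw [abs_sub_comm, abs_sub_comm t, abs_of_nonneg (sub_nonneg.2 (hp.mono h)),
      abs_of_nonneg (sub_nonneg.2 h)]
    exact hp.lip t r h

/-- The transition function lacks compact support, but it is a compactly supported `C¹` function
composed with `min x 1`, which is 1-Lipschitz. -/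
theorem exists_smoothTransition_lipschitz : ∃ L : ℝ, 0 ≤ L ∧ ∀ r t : ℝ, r ≤ t →
    Real.smoothTransition t - Real.smoothTransition r ≤ L * (t - r) := by
  set q : ℝ → ℝ := fun x => Real.smoothTransition x * Real.smoothTransition (2 - x)
  have hq : ContDiff ℝ 1 q := Real.smoothTransition.contDiff.mul
    (Real.smoothTransition.contDiff.comp (contDiff_const.sub contDiff_id))
  have hs : HasCompactSupport q := by
    refine HasCompactSupport.intro (isCompact_Icc (a := (0 : ℝ)) (b := 2)) fun x hx => ?_
    rw [mem_Icc, not_and_or, not_le, not_le] at hx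
    rcases hx with hx | hx
    · simp [q, Real.smoothTransition.zero_of_nonpos hx.le]
    · simp [q, Real.smoothTransition.zero_of_nonpos (show 2 - x ≤ 0 by linarith)]
  obtain ⟨L, hL⟩ := hq.lipschitzWith_of_hasCompactSupport hs one_ne_zero
  have hmin : ∀ x, Real.smoothTransition x = q (min x 1) := by
    intro x
    rcases le_total x 1 with hx | hx
    · simp [q, min_eq_left hx, Real.smoothTransition.one_of_one_le (show 1 ≤ 2 - x by linarith)]
    · rw [min_eq_right hx, Real.smoothTransition.one_of_one_le hx]
      norm_num [q]
  refine ⟨L, L.2, fun r t hrt => ?_⟩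
  have h1 := hL.dist_le_mul (min t 1) (min r 1)
  rw [Real.dist_eq, ← hmin, ← hmin, Real.dist_eq] at h1
  refine (le_abs_self _).trans (h1.trans (mul_le_mul_of_nonneg_left ?_ L.2))
  have h2 := min_le_min_right (1 : ℝ) hrt
  rw [abs_of_nonneg (sub_nonneg.2 h2)]
  rcases le_total t 1 with ht | ht <;> rcases le_total r 1 with hr | hr <;> simp [ht, hr] <;>
    linarith

/-- Steep approximations of the Heaviside function at `b`, normalised to vanish at `0`. -/
theorem exists_isTruncation_steep (j b : ℝ) (hj : 0 ≤ j) : ∃ L, IsTruncation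
    (fun t => Real.smoothTransition (j * (t - b)) - Real.smoothTransition (j * (0 - b))) L 1 := by
  obtain ⟨L, hL0, hL⟩ := exists_smoothTransition_lipschitz
  refine ⟨L * j, ⟨?_, ?_, ?_, ?_⟩⟩
  · exact (Real.smoothTransition.contDiff.comp
      (contDiff_const.mul (contDiff_id.sub contDiff_const))).sub contDiff_const
  · intro r t hrt
    have := Real.smoothTransition.monotone
      (mul_le_mul_of_nonneg_left (sub_le_sub_right hrt b) hj)
    simpa using this
  · intro r t hrt
    have := hL _ _ (mul_le_mul_of_nonneg_left (sub_le_sub_right hrt b) hj)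
    linarith
  · intro t
    have h1 := Real.smoothTransition.nonneg (j * (t - b))
    have h2 := Real.smoothTransition.le_one (j * (t - b))
    have h3 := Real.smoothTransition.nonneg (j * (0 - b))
    have h4 := Real.smoothTransition.le_one (j * (0 - b))
    rw [abs_le]; constructor <;> linarith

/-! ### Testing against truncations of elements of `Ḣ^s` -/

/-- A uniform bound lets `h` be replaced by a compactly supported continuous function at small cost
in `L¹`; against that function local convergence is enough. -/
theorem tendsto_integral_mul_of_tendsto_L1_loc {N : ℕ} {h w : Space N → ℝ}
    {wk : ℕ → Space N → ℝ} {M : ℝ} (hh : Integrable h) (hw : AEStronglyMeasurable w)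
    (hwk : ∀ k, AEStronglyMeasurable (wk k)) (hM : ∀ x, |w x| ≤ M) (hMk : ∀ k x, |wk k x| ≤ M)
    (hlim : ∀ K : Set (Space N), IsCompact K →
      Tendsto (fun k => eLpNorm (fun x => wk k x - w x) 1 (volume.restrict K)) atTop (𝓝 0)) :
    Tendsto (fun k => ∫ x, h x * wk k x) atTop (𝓝 (∫ x, h x * w x)) := by
  have hM0 : 0 ≤ M := (abs_nonneg _).trans (hM 0)
  have hi : Integrable (fun x => h x * w x) := hh.mul_bdd hw (ae_of_all _ hM)
  have hik : ∀ k, Integrable (fun x => h x * wk k x) := fun k =>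
    hh.mul_bdd (hwk k) (ae_of_all _ (hMk k))
  rw [Metric.tendsto_atTop]
  intro ε hε
  -- The replacement of `h` costs at most `2Mδ ≤ ε/2`; the extra `1` covers `M = 0`.
  set δ := ε / (2 * (2 * M + 1)) with hδ
  have hδ0 : 0 < δ := by positivity
  obtain ⟨h', hcs, hle, hcont, hint⟩ := hh.exists_hasCompactSupport_integral_sub_le hδ0
  obtain ⟨B, hB⟩ := hcs.exists_bound_of_continuous hcont
  have hB0 : 0 ≤ B := (norm_nonneg _).trans (hB 0)
  set K := tsupport h' with hKdef
  have hK : IsCompact K := hcs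
  have hreal : Tendsto (fun k => B * (eLpNorm (fun x => wk k x - w x) 1 (volume.restrict K)).toReal)
      atTop (𝓝 0) := by
    simpa using ((ENNReal.tendsto_toReal ENNReal.zero_ne_top).comp (hlim K hK)).const_mul B
  obtain ⟨k₀, hk₀⟩ := (Metric.tendsto_atTop.1 hreal) (ε / 2) (half_pos hε)
  refine ⟨k₀, fun k hk => ?_⟩
  have hk := hk₀ k hk
  rw [Real.dist_eq, sub_zero, abs_of_nonneg (by positivity)] at hk
  have hdm : AEStronglyMeasurable (fun x => wk k x - w x) := (hwk k).sub hw
  have hdb : ∀ x, |wk k x - w x| ≤ 2 * M := fun x => by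
    have := abs_sub (wk k x) (w x)
    linarith [hM x, hMk k x]
  have hdK : IntegrableOn (fun x => |wk k x - w x|) K :=
    Integrable.abs <| IntegrableOn.of_bound hK.measure_lt_top hdm.restrict (2 * M)
      (ae_of_all _ hdb)
  have hnorm : (eLpNorm (fun x => wk k x - w x) 1 (volume.restrict K)).toReal
      = ∫ x in K, |wk k x - w x| := by
    rw [eLpNorm_one_eq_lintegral_enorm]
    exact (integral_norm_eq_lintegral_enorm hdm.restrict).symm
  have hsub : Integrable (fun x => ‖h x - h' x‖) := (hh.sub hint).norm
  have hbound : |∫ x, h x * (wk k x - w x)| ≤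
      ∫ x, (2 * M * ‖h x - h' x‖ + B * K.indicator (fun x => |wk k x - w x|) x) := by
    rw [← Real.norm_eq_abs]
    refine norm_integral_le_of_norm_le ((hsub.const_mul _).add
      ((hdK.integrable_indicator hK.measurableSet).const_mul B)) (ae_of_all _ fun x => ?_)
    have e1 : h x * (wk k x - w x) = (h x - h' x) * (wk k x - w x) + h' x * (wk k x - w x) := by
      ring
    rw [e1]
    refine (norm_add_le _ _).trans (add_le_add ?_ ?_)
    · rw [norm_mul, mul_comm]
      exact mul_le_mul_of_nonneg_right (hdb x) (norm_nonneg _)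
    · by_cases hx : x ∈ K
      · rw [indicator_of_mem hx, norm_mul]
        exact mul_le_mul_of_nonneg_right (hB x) (norm_nonneg _)
      · rw [indicator_of_notMem hx, image_eq_zero_of_notMem_tsupport hx]; simp
  rw [integral_add (hsub.const_mul _)
    ((hdK.integrable_indicator hK.measurableSet).const_mul B), integral_const_mul,
    integral_const_mul, integral_indicator hK.measurableSet, ← hnorm] at hbound
  rw [Real.dist_eq, ← integral_sub (hik k) hi]
  simp only [← mul_sub]
  have h5 : 2 * M * ∫ x, ‖h x - h' x‖ ≤ 2 * M * δ := mul_le_mul_of_nonneg_left hle (by positivity)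
  have h6 : 2 * M * δ ≤ ε / 2 := by
    have : (2 * M + 1) * δ = ε / 2 := by rw [hδ]; field_simp
    nlinarith
  linarith

theorem norm2_le_norm2_sub_add {N : ℕ} {f g : Space N → ℝ} (hf : MemLp f 2) (hg : MemLp g 2) :
    norm2 f ≤ norm2 (fun x => f x - g x) + norm2 g := by
  have h := eLpNorm_add_le (hf.sub hg).1 hg.1 (by norm_num : (1 : ENNReal) ≤ 2)
  rw [sub_add_cancel] at h
  have h1 := (hf.sub hg).eLpNorm_ne_top
  have := ENNReal.toReal_mono (ENNReal.add_ne_top.2 ⟨h1, hg.eLpNorm_ne_top⟩) h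
  rw [ENNReal.toReal_add h1 hg.eLpNorm_ne_top] at this
  exact this

variable {N : ℕ} {s : ℝ} {W G h : Space N → ℝ} {p : ℝ → ℝ} {L M : ℝ}

/-- Truncating the approximating test functions of an element of `Ḣ^s`. -/
theorem HasHalfLap.exists_truncated_approx (hN : 1 ≤ N) (hs : 0 < s) (hs1 : s < 1)
    (hW : HasHalfLap s W G) (hp : IsTruncation p L M) (hp0 : p 0 = 0) :
    ∃ (ψ : ℕ → Space N → ℝ) (d : ℕ → ℝ), (∀ k, IsTest (ψ k)) ∧ Tendsto d atTop (𝓝 0) ∧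
      (∀ k, norm2 (fun x => fracLap (s / 2) (ψ k) x - G x) = d k) ∧
      (∀ k, norm2 (fracLap (s / 2) (fun x => p (ψ k x))) ≤ L * (d k + norm2 G)) ∧
      ∀ h : Space N → ℝ, Integrable h →
        Tendsto (fun k => ∫ x, h x * p (ψ k x)) atTop (𝓝 (∫ x, h x * p (W x))) := by
  obtain ⟨ψ, hψ, hloc, hL2⟩ := hW.approx
  have hL0 : 0 ≤ L := by
    have := hp.lip 0 1 zero_le_one
    have h2 := hp.mono (zero_le_one' ℝ)
    linarith
  have hpc : Continuous p := hp.contDiff.continuous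
  refine ⟨ψ, fun k => norm2 (fun x => fracLap (s / 2) (ψ k) x - G x), hψ, ?_, fun k => rfl,
    fun k => ?_, fun h hh => ?_⟩
  · simpa using! (ENNReal.tendsto_toReal ENNReal.zero_ne_top).comp hL2
  · refine ((hψ k).norm2_fracLap_comp_le hN hp.contDiff hp0 hp.mono hp.lip hs hs1).trans ?_
    exact mul_le_mul_of_nonneg_left
      (norm2_le_norm2_sub_add ((hψ k).memLp_fracLap hN hs hs1) hW.memLp) hL0
  · have hWm := hW.locallyIntegrable.aestronglyMeasurable
    refine tendsto_integral_mul_of_tendsto_L1_loc (M := M) hh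
      (hpc.comp_aestronglyMeasurable hWm)
      (fun k => (hpc.comp (hψ k).continuous).aestronglyMeasurable) (fun x => hp.bound _)
      (fun k x => hp.bound _) fun K hK => ?_
    have h0 : Tendsto (fun k => ENNReal.ofReal L *
        eLpNorm (fun x => ψ k x - W x) 1 (volume.restrict K)) atTop (𝓝 0) := by
      simpa using ENNReal.Tendsto.const_mul (hloc K hK) (Or.inr ENNReal.ofReal_ne_top)
    refine tendsto_of_tendsto_of_tendsto_of_le_of_le tendsto_const_nhds h0 (fun k => zero_le)
      fun k => ?_
    exact eLpNorm_le_mul_eLpNorm_of_ae_le_mul (ae_of_all _ fun x => hp.abs_sub_le _ _) 1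

/-- Testing with `p(ψ_k)` leaves `-∫ G (-Δ)^{s/2} p(ψ_k)`. Replacing `G` by the half Laplacian of
`ψ_k` makes this nonpositive, at a cost of at most `d k * (L * (d k + norm2 G))`, which tends to
zero. -/
theorem HasHalfLap.integral_mul_comp_nonpos (hN : 1 ≤ N) (hs : 0 < s) (hs1 : s < 1)
    (hW : HasHalfLap s W G) (hh : Integrable h)
    (heq : ∀ ψ, IsTest ψ → (∫ x, h x * ψ x) + (∫ x, G x * fracLap (s / 2) ψ x) = 0)
    (hp : IsTruncation p L M) (hp0 : p 0 = 0) : ∫ x, h x * p (W x) ≤ 0 := by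
  obtain ⟨ψ, d, hψ, hd, hdk, hnk, hlim⟩ := hW.exists_truncated_approx hN hs hs1 hp hp0
  have hr : Tendsto (fun k => d k * (L * (d k + norm2 G))) atTop (𝓝 0) := by
    simpa using hd.mul ((hd.add_const (norm2 G)).const_mul L)
  refine le_of_tendsto_of_tendsto' (hlim h hh) hr fun k => ?_
  have hpψ := (hψ k).comp_left hp.contDiff hp0
  have hT := (hψ k).memLp_fracLap hN hs hs1
  have hT' := hpψ.memLp_fracLap hN hs hs1
  have hG := hW.memLp
  have h1 := heq _ hpψ
  have h2 := (hψ k).integral_fracLap_mul_comp_nonneg hN hp.contDiff hp0 hp.mono hs hs1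
  have h3 := (le_abs_self _).trans (abs_integral_mul_le (hT.sub hG) hT')
  have h4 : ∫ x, (fracLap (s / 2) (ψ k) - G) x * fracLap (s / 2) (fun x => p (ψ k x)) x
      = (∫ x, fracLap (s / 2) (ψ k) x * fracLap (s / 2) (fun x => p (ψ k x)) x)
        - ∫ x, G x * fracLap (s / 2) (fun x => p (ψ k x)) x := by
    rw [← integral_sub (integrable_mul_of_memLp_two hT hT') (integrable_mul_of_memLp_two hG hT')]
    refine integral_congr_ae (ae_of_all _ fun x => ?_)
    simp only [Pi.sub_apply]; ring
  have h5 : norm2 (fracLap (s / 2) (ψ k) - G) = d k := hdk k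
  have hd0 : 0 ≤ d k := h5 ▸ norm2_nonneg _
  have h6 := mul_le_mul_of_nonneg_left (hnk k) hd0
  rw [h4, h5] at h3
  linarith

/-! ### Dilations and conservation of mass -/

/-- The operator has order `s`, and the change of variables in `L²` contributes `t^(-N/2)`. The sign
of `s - N/2` separates the two regimes of the proof. -/
theorem IsTest.norm2_fracLap_comp_smul {ψ : Space N → ℝ} (hN : 1 ≤ N) (hψ : IsTest ψ) {t : ℝ}
    (ht : 0 < t) (hs : 0 < s) (hs1 : s < 1) :
    norm2 (fracLap (s / 2) (fun x => ψ (t • x))) = t ^ (s - N / 2) * norm2 (fracLap (s / 2) ψ) := by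
  have h : norm2 (fracLap (s / 2) (fun x => ψ (t • x))) ^ 2
      = (t ^ (s - N / 2) * norm2 (fracLap (s / 2) ψ)) ^ 2 := by
    rw [mul_pow, norm2_sq ((hψ.comp_smul ht.ne').memLp_fracLap hN hs hs1),
      norm2_sq (hψ.memLp_fracLap hN hs hs1)]
    have hsc := Measure.integral_comp_smul (volume : Measure (Space N))
      (fun x => fracLap (s / 2) ψ x * fracLap (s / 2) ψ x) t
    rw [finrank_euclideanSpace_fin, abs_of_pos (by positivity), smul_eq_mul] at hsc
    have h1 : ∀ x, fracLap (s / 2) (fun x => ψ (t • x)) x * fracLap (s / 2) (fun x => ψ (t • x)) x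
        = (t ^ s) ^ 2 * (fracLap (s / 2) ψ (t • x) * fracLap (s / 2) ψ (t • x)) := by
      intro x
      rw [hψ.fracLap_comp_smul hN ht hs hs1]; ring
    simp only [h1]
    rw [integral_const_mul, hsc, ← mul_assoc]
    congr 1
    rw [← Real.rpow_natCast t N, ← Real.rpow_neg ht.le, ← Real.rpow_natCast,
      ← Real.rpow_natCast, ← Real.rpow_mul ht.le, ← Real.rpow_mul ht.le, ← Real.rpow_add ht]
    congr 1; push_cast; ring
  exact (pow_left_inj₀ (norm2_nonneg _) (mul_nonneg (by positivity) (norm2_nonneg _))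
    two_ne_zero).1 h

theorem exists_isTest_bump (N : ℕ) : ∃ χ : Space N → ℝ, IsTest χ ∧ χ 0 = 1 ∧
    (∀ x, 0 ≤ χ x) ∧ (∀ x, χ x ≤ 1) ∧ 0 < ∫ x, χ x := by
  let χ : ContDiffBump (0 : Space N) := ⟨1, 2, one_pos, one_lt_two⟩
  exact ⟨χ, ⟨χ.contDiff, χ.hasCompactSupport⟩, χ.one_of_mem_closedBall (by simp [χ]), fun x => χ.nonneg,
    fun x => χ.le_one, χ.integral_pos⟩

/-- In the range `N ≤ 2s`, constants are admissible test functions. -/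
theorem HasHalfLap.integral_eq_zero (hN : 1 ≤ N) (hs : 0 < s) (hs1 : s < 1)
    (hNs : (N : ℝ) ≤ 2 * s) (hW : HasHalfLap s W G) (hh : Integrable h)
    (heq : ∀ ψ, IsTest ψ → (∫ x, h x * ψ x) + (∫ x, G x * fracLap (s / 2) ψ x) = 0) :
    ∫ x, h x = 0 := by
  obtain ⟨χ, hχ, hχ0, hχn, hχ1, -⟩ := exists_isTest_bump N
  set t : ℕ → ℝ := fun j => 1 / ((j : ℝ) + 1)
  have ht0 : ∀ j, 0 < t j := fun j => by positivity
  have ht1 : ∀ j, t j ≤ 1 := fun j => by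
    rw [div_le_one (by positivity)]; linarith [Nat.cast_nonneg (α := ℝ) j]
  have htlim : Tendsto t atTop (𝓝 0) := tendsto_one_div_add_atTop_nhds_zero_nat
  have hmass : Tendsto (fun j => ∫ x, h x * χ (t j • x)) atTop (𝓝 (∫ x, h x)) := by
    refine tendsto_integral_of_dominated_convergence (fun x => ‖h x‖)
      (fun j => hh.1.mul (hχ.comp_smul (ht0 j).ne').continuous.aestronglyMeasurable) hh.norm
      (fun j => ae_of_all _ fun x => ?_) (ae_of_all _ fun x => ?_)
    · rw [norm_mul, Real.norm_of_nonneg (hχn _)]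
      exact mul_le_of_le_one_right (norm_nonneg _) (hχ1 _)
    · have h1 : Tendsto (fun j => t j • x) atTop (𝓝 0) := by simpa using htlim.smul_const x
      have h2 := (hχ.continuous.tendsto 0).comp h1
      simpa [hχ0] using h2.const_mul (h x)
  -- When `s = N/2` the dilates of `χ` stay bounded in energy without decaying. Hence `G` is first
  -- approximated in `L²` by a half Laplacian of a test function; that function is in `L¹`, while
  -- the half Laplacian of the dilate is `O(t^s)` uniformly.
  have henergy : Tendsto (fun j => ∫ x, G x * fracLap (s / 2) (fun x => χ (t j • x)) x) atTop
      (𝓝 0) := by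
    obtain ⟨ψ, hψ, -, hL2⟩ := hW.approx
    obtain ⟨B, hB0, hB⟩ := hχ.exists_abs_fracLap_le hN hs hs1
    have hd : Tendsto (fun k => norm2 (fun x => fracLap (s / 2) (ψ k) x - G x)) atTop (𝓝 0) := by
      simpa using! (ENNReal.tendsto_toReal ENNReal.zero_ne_top).comp hL2
    have hkey : ∀ k j, |∫ x, G x * fracLap (s / 2) (fun x => χ (t j • x)) x| ≤
        norm2 (fun x => fracLap (s / 2) (ψ k) x - G x) * norm2 (fracLap (s / 2) χ)
          + (∫ x, |fracLap (s / 2) (ψ k) x|) * (t j ^ s * B) := by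
      intro k j
      have hT := (hψ k).memLp_fracLap hN hs hs1
      have hχt := (hχ.comp_smul (ht0 j).ne').memLp_fracLap hN hs hs1
      have h1 : ∫ x, G x * fracLap (s / 2) (fun x => χ (t j • x)) x
          = (∫ x, fracLap (s / 2) (ψ k) x * fracLap (s / 2) (fun x => χ (t j • x)) x)
            - ∫ x, (fracLap (s / 2) (ψ k) - G) x * fracLap (s / 2) (fun x => χ (t j • x)) x := by
        rw [← integral_sub (integrable_mul_of_memLp_two hT hχt)
          (integrable_mul_of_memLp_two (hT.sub hW.memLp) hχt)]
        refine integral_congr_ae (ae_of_all _ fun x => ?_)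
        simp only [Pi.sub_apply]; ring
      have h2 := abs_integral_mul_le (hT.sub hW.memLp) hχt
      rw [hχ.norm2_fracLap_comp_smul hN (ht0 j) hs hs1] at h2
      have h3 : t j ^ (s - N / 2) ≤ 1 := Real.rpow_le_one (ht0 j).le (ht1 j) (by linarith)
      have h4 : norm2 (fracLap (s / 2) (ψ k) - G) *
          (t j ^ (s - N / 2) * norm2 (fracLap (s / 2) χ))
          ≤ norm2 (fracLap (s / 2) (ψ k) - G) * norm2 (fracLap (s / 2) χ) :=
        mul_le_mul_of_nonneg_left (mul_le_of_le_one_left (norm2_nonneg _) h3) (norm2_nonneg _)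
      have h5 : |∫ x, fracLap (s / 2) (ψ k) x * fracLap (s / 2) (fun x => χ (t j • x)) x|
          ≤ (∫ x, |fracLap (s / 2) (ψ k) x|) * (t j ^ s * B) := by
        rw [← integral_mul_const, ← Real.norm_eq_abs]
        refine norm_integral_le_of_norm_le
          (((hψ k).integrable_fracLap hN hs hs1).abs.mul_const _) (ae_of_all _ fun x => ?_)
        rw [norm_mul, hχ.fracLap_comp_smul hN (ht0 j) hs hs1, norm_mul,
          Real.norm_of_nonneg (Real.rpow_nonneg (ht0 j).le s)]
        exact mul_le_mul_of_nonneg_left (mul_le_mul_of_nonneg_left (hB _)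
          (Real.rpow_nonneg (ht0 j).le s)) (norm_nonneg _)
      have h6 : norm2 (fracLap (s / 2) (ψ k) - G)
          = norm2 (fun x => fracLap (s / 2) (ψ k) x - G x) := rfl
      rw [h1, ← h6]
      refine (abs_sub _ _).trans ?_
      linarith
    rw [Metric.tendsto_atTop]
    intro ε hε
    obtain ⟨k, hk⟩ := ((hd.mul_const (norm2 (fracLap (s / 2) χ))).eventually_lt_const
      (by rw [zero_mul]; exact half_pos hε)).exists
    have htp : Tendsto (fun j => (∫ x, |fracLap (s / 2) (ψ k) x|) * (t j ^ s * B)) atTop (𝓝 0) := by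
      have : Tendsto (fun j => t j ^ s) atTop (𝓝 0) := by
        simpa [Real.zero_rpow hs.ne', Function.comp_def] using
          (Real.continuousAt_rpow_const 0 s (Or.inr hs.le)).tendsto.comp htlim
      simpa using (this.mul_const B).const_mul (∫ x, |fracLap (s / 2) (ψ k) x|)
    obtain ⟨j₀, hj₀⟩ := eventually_atTop.1 (htp.eventually_lt_const (half_pos hε))
    refine ⟨j₀, fun j hj => ?_⟩
    rw [Real.dist_eq, sub_zero]
    linarith [hkey k j, hj₀ j hj]
  have hsum := hmass.add henergy
  simp only [fun j => heq _ (hχ.comp_smul (ht0 j).ne')] at hsum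
  simpa using tendsto_nhds_unique hsum tendsto_const_nhds

/-! ### The range `2s < N`: elements of `Ḣ^s` vanish at infinity in mean -/

theorem ae_ne_zero {N : ℕ} (hN : 1 ≤ N) : ∀ᵐ ξ : Space N, ξ ≠ 0 := by
  have : Nonempty (Fin N) := ⟨⟨0, hN⟩⟩
  exact Measure.ae_ne volume 0

/-- This is where `2s < N` enters: it makes `‖ξ‖^(-2s)` integrable at the origin. The function is
the dual factor in the Cauchy-Schwarz estimate that follows. -/
theorem IsTest.memLp_rpow_neg_mul_ft {N : ℕ} {χ : Space N → ℝ} {s : ℝ} (hN : 1 ≤ N)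
    (hχ : IsTest χ) (hs : 0 < s) (hNs : 2 * s < N) :
    MemLp (fun ξ => ‖ξ‖ ^ (-s) * ‖ft χ ξ‖) 2 := by
  obtain ⟨B, hB0, hB⟩ := exists_norm_ft_le χ
  have hc := hχ.continuous_ft
  have hm : Measurable (fun ξ => ‖ξ‖ ^ (-s) * ‖ft χ ξ‖) := by fun_prop
  rw [memLp_two_iff_integrable_sq hm.aestronglyMeasurable]
  -- The exponents are chosen so that the integrand equals `‖ξ‖^(-2s)` on the unit ball.
  have hk := integrable_min_mul_kernel hN (a := 1) (m := N + 1 - 2 * s) one_pos (by linarith)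
  refine ((hk.const_mul (B ^ 2)).add (hχ.integrable_ft.norm.const_mul B)).mono'
    (hm.pow_const 2).aestronglyMeasurable ?_
  filter_upwards [ae_ne_zero hN] with ξ hξ
  have hξ0 : 0 < ‖ξ‖ := norm_pos_iff.2 hξ
  have hf := norm_nonneg (ft χ ξ)
  rw [Real.norm_of_nonneg (by positivity), mul_pow]
  have hsq : ‖ft χ ξ‖ ^ 2 ≤ B * ‖ft χ ξ‖ := by
    rw [sq]; exact mul_le_mul_of_nonneg_right (hB ξ) hf
  have hsq' : ‖ft χ ξ‖ ^ 2 ≤ B ^ 2 := pow_le_pow_left₀ hf (hB ξ) 2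
  simp only [Pi.add_apply]
  rcases le_total ‖ξ‖ 1 with h1 | h1
  · have e : min 1 (‖ξ‖ ^ ((N : ℝ) + 1 - 2 * s)) * kernel 1 ξ = (‖ξ‖ ^ (-s)) ^ 2 := by
      rw [min_eq_right (Real.rpow_le_one hξ0.le h1 (by linarith)), kernel,
        ← Real.rpow_neg hξ0.le, ← Real.rpow_add hξ0, ← Real.rpow_natCast, ← Real.rpow_mul hξ0.le]
      congr 1; push_cast; ring
    rw [e, mul_comm (B ^ 2)]
    have := mul_le_mul_of_nonneg_left hsq' (sq_nonneg (‖ξ‖ ^ (-s)))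
    have h2 : 0 ≤ B * ‖ft χ ξ‖ := by positivity
    linarith
  · have e : (‖ξ‖ ^ (-s)) ^ 2 ≤ 1 :=
      pow_le_one₀ (by positivity) (Real.rpow_le_one_of_one_le_of_nonpos h1 (by linarith))
    have h2 : 0 ≤ B ^ 2 * (min 1 (‖ξ‖ ^ ((N : ℝ) + 1 - 2 * s)) * kernel 1 ξ) :=
      mul_nonneg (by positivity) (mul_nonneg (by positivity) (kernel_nonneg _ _))
    have h3 := mul_le_mul_of_nonneg_right e (sq_nonneg ‖ft χ ξ‖)
    linarith

/-- For `2s < N`, integration against a test function is bounded in the energy norm. -/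
theorem IsTest.exists_abs_integral_mul_le {N : ℕ} {χ : Space N → ℝ} {s : ℝ} (hN : 1 ≤ N)
    (hχ : IsTest χ) (hs : 0 < s) (hs1 : s < 1) (hNs : 2 * s < N) :
    ∃ C, 0 ≤ C ∧ ∀ ψ, IsTest ψ → |∫ x, ψ x * χ x| ≤ C * norm2 (fracLap (s / 2) ψ) := by
  have hSC : 0 < ‖symbolConst hN s‖ := norm_pos_iff.2 (symbolConst_ne_zero hN hs hs1)
  have hB := hχ.memLp_rpow_neg_mul_ft hN hs hNs
  refine ⟨norm2 (fun ξ => ‖ξ‖ ^ (-s) * ‖ft χ ξ‖) / ‖symbolConst hN s‖,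
    div_nonneg (norm2_nonneg _) hSC.le, fun ψ hψ => ?_⟩
  have hc := hψ.continuous_ft
  have hm : Measurable (fun ξ => ‖ξ‖ ^ s * ‖ft ψ ξ‖) := by fun_prop
  have hsq : ∀ ξ, ‖ξ‖ ^ s * ‖ft ψ ξ‖ * (‖ξ‖ ^ s * ‖ft ψ ξ‖)
      = ‖ξ‖ ^ (2 * s) * ‖ft ψ ξ‖ ^ 2 := fun ξ => by
    rw [two_mul, Real.rpow_add_of_nonneg (norm_nonneg _) hs.le hs.le]; ring
  obtain ⟨B, hB0, hBψ⟩ := exists_norm_ft_le ψ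
  have hA : MemLp (fun ξ => ‖ξ‖ ^ s * ‖ft ψ ξ‖) 2 := by
    rw [memLp_two_iff_integrable_sq hm.aestronglyMeasurable]
    simp only [sq (_ * _), hsq]
    refine ((hψ.integrable_rpow_mul_ft (a := 2 * s) (by linarith) (by linarith)).const_mul B).mono'
      (Measurable.aestronglyMeasurable (by fun_prop)) (ae_of_all _ fun ξ => ?_)
    rw [Real.norm_of_nonneg (by positivity), sq, mul_left_comm B]
    exact mul_le_mul_of_nonneg_left (mul_le_mul_of_nonneg_right (hBψ ξ) (norm_nonneg _))
      (by positivity)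
  have hE : norm2 (fracLap (s / 2) ψ) = ‖symbolConst hN s‖ * norm2 (fun ξ => ‖ξ‖ ^ s * ‖ft ψ ξ‖) := by
    refine (pow_left_inj₀ (norm2_nonneg _) (mul_nonneg hSC.le (norm2_nonneg _)) two_ne_zero).1 ?_
    rw [mul_pow, norm2_sq hA, norm2_sq (hψ.memLp_fracLap hN hs hs1)]
    simp only [hsq]
    apply Complex.ofReal_injective
    rw [hψ.ofReal_integral_fracLap_mul hN hψ hs hs1, Complex.ofReal_mul, ← integral_complex_ofReal]
    congr 1
    refine integral_congr_ae (ae_of_all _ fun ξ => ?_)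
    simp only [Complex.conj_mul']
    push_cast; rfl
  have h1 : |∫ x, ψ x * χ x| ≤ ∫ ξ, (‖ξ‖ ^ s * ‖ft ψ ξ‖) * (‖ξ‖ ^ (-s) * ‖ft χ ξ‖) := by
    rw [← Real.norm_eq_abs, ← Complex.norm_real, ofReal_integral_mul_eq_integral_ft hψ.integrable
      hχ.integrable hχ.continuous hχ.integrable_ft]
    refine norm_integral_le_of_norm_le (integrable_mul_of_memLp_two hA hB) ?_
    filter_upwards [ae_ne_zero hN] with ξ hξ
    have hξ0 : 0 < ‖ξ‖ := norm_pos_iff.2 hξ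
    rw [norm_mul, RCLike.norm_conj, mul_mul_mul_comm, ← Real.rpow_add hξ0, add_neg_cancel,
      Real.rpow_zero, one_mul]
  refine h1.trans ((le_abs_self _).trans ((abs_integral_mul_le hA hB).trans_eq ?_))
  rw [hE]; field_simp

/-- Rescaling by `R` shows that averages at scale `R` decay like `R^(s - N/2)`: finite energy forces
vanishing at infinity in mean. -/
theorem IsTest.exists_abs_integral_mul_dilate_le {N : ℕ} {χ : Space N → ℝ} {s : ℝ} (hN : 1 ≤ N)
    (hχ : IsTest χ) (hs : 0 < s) (hs1 : s < 1) (hNs : 2 * s < N) :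
    ∃ C, 0 ≤ C ∧ ∀ R : ℝ, 0 < R → ∀ ψ, IsTest ψ →
      |∫ x, χ (R⁻¹ • x) * ψ x| ≤ R ^ N * (R ^ (s - N / 2) * (C * norm2 (fracLap (s / 2) ψ))) := by
  obtain ⟨C, hC0, hC⟩ := hχ.exists_abs_integral_mul_le hN hs hs1 hNs
  refine ⟨C, hC0, fun R hR ψ hψ => ?_⟩
  have h1 := hC _ (hψ.comp_smul hR.ne')
  rw [hψ.norm2_fracLap_comp_smul hN hR hs hs1] at h1
  have hsc := Measure.integral_comp_smul (volume : Measure (Space N))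
    (fun x => χ (R⁻¹ • x) * ψ x) R
  rw [finrank_euclideanSpace_fin, abs_of_pos (by positivity), smul_eq_mul] at hsc
  simp only [inv_smul_smul₀ hR.ne'] at hsc
  have h2 : ∫ x, χ (R⁻¹ • x) * ψ x = R ^ N * ∫ x, ψ (R • x) * χ x := by
    simp only [mul_comm (ψ _)]
    rw [hsc, mul_inv_cancel_left₀ (pow_ne_zero N hR.ne')]
  rw [h2, abs_mul, abs_of_pos (by positivity)]
  refine mul_le_mul_of_nonneg_left (h1.trans_eq (by ring)) (by positivity)

/-- The threshold `e^{-1}` serves the logarithm and all the powers at once. -/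
theorem phi_le_neg_one {n u : ℝ} (hn : 0 ≤ n) (hu : 0 < u) (hu1 : u ≤ Real.exp (-1)) :
    phi n u ≤ -1 := by
  unfold phi
  split_ifs with h
  · exact (Real.log_le_iff_le_exp hu).2 hu1
  · have h1 : u ≤ 1 := hu1.trans (Real.exp_le_one_iff.2 (by norm_num))
    have := Real.one_le_rpow_of_pos_of_le_one_of_nonpos hu h1 (by linarith : -n ≤ 0)
    linarith

/-- For `2s < N` no positive integrable function `u` has `φ(u) ∈ Ḣ^s`. -/
theorem not_hasHalfLap_phi {N : ℕ} {s n : ℝ} {u g : Space N → ℝ} (hN : 1 ≤ N) (hs : 0 < s)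
    (hs1 : s < 1) (hn : 0 ≤ n) (hNs : 2 * s < N) (hu : Integrable u) (hpos : ∀ᵐ x, 0 < u x) :
    ¬ HasHalfLap s (fun x => phi n (u x)) g := by
  intro hW
  obtain ⟨χ, hχ, -, hχn, hχ1, hχI⟩ := exists_isTest_bump N
  obtain ⟨L, hL0, hL⟩ := exists_smoothTransition_lipschitz
  obtain ⟨C, hC0, hC⟩ := hχ.exists_abs_integral_mul_dilate_le hN hs hs1 hNs
  -- This truncation vanishes on `[0, ∞)` and equals `-1` on `(-∞, -1]`, so `p(φ(u)) = -1` wherever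
  -- `u ≤ e^{-1}`.
  set p : ℝ → ℝ := fun t => -Real.smoothTransition (-t) with hpdef
  have hp : IsTruncation p L 1 := by
    refine ⟨(Real.smoothTransition.contDiff.comp contDiff_neg).neg, fun r t hrt =>
      neg_le_neg (Real.smoothTransition.monotone (neg_le_neg hrt)), fun r t hrt => ?_, fun t => ?_⟩
    · have := hL _ _ (neg_le_neg hrt)
      simp only [hpdef]; linarith
    · rw [hpdef, abs_neg, abs_of_nonneg (Real.smoothTransition.nonneg _)]
      exact Real.smoothTransition.le_one _
  have hp0 : p 0 = 0 := by simp [hpdef]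
  obtain ⟨ψ, d, hψ, hd, -, hnk, hlim⟩ := hW.exists_truncated_approx hN hs hs1 hp hp0
  have hpm : AEStronglyMeasurable (fun x => p (phi n (u x))) :=
    hp.contDiff.continuous.comp_aestronglyMeasurable hW.locallyIntegrable.aestronglyMeasurable
  have hup : ∀ R : ℝ, 0 < R → |∫ x, χ (R⁻¹ • x) * p (phi n (u x))|
      ≤ R ^ N * (R ^ (s - N / 2) * (C * (L * norm2 g))) := by
    intro R hR
    have hχR := (hχ.comp_smul (inv_ne_zero hR.ne')).integrable
    have hb : Tendsto (fun k => R ^ N * (R ^ (s - N / 2) * (C * (L * (d k + norm2 g))))) atTop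
        (𝓝 (R ^ N * (R ^ (s - N / 2) * (C * (L * norm2 g))))) := by
      simpa using ((((hd.add_const (norm2 g)).const_mul L).const_mul C).const_mul
        (R ^ (s - N / 2))).const_mul (R ^ N)
    refine le_of_tendsto_of_tendsto' (hlim _ hχR).abs hb fun k => ?_
    refine (hC R hR _ ((hψ k).comp_left hp.contDiff hp0)).trans ?_
    exact mul_le_mul_of_nonneg_left (mul_le_mul_of_nonneg_left (mul_le_mul_of_nonneg_left (hnk k)
      hC0) (by positivity)) (by positivity)
  have hmain : ∀ R : ℝ, 0 < R → (∫ x, χ x) ≤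
      (R ^ N)⁻¹ * (Real.exp 1 * ∫ x, u x) + R ^ (s - N / 2) * (C * (L * norm2 g)) := by
    intro R hR
    have hχR := (hχ.comp_smul (inv_ne_zero hR.ne')).integrable
    have hsc := Measure.integral_comp_inv_smul_of_nonneg (volume : Measure (Space N)) χ
      (R := R) hR.le
    rw [finrank_euclideanSpace_fin, smul_eq_mul] at hsc
    have hi : Integrable (fun x => χ (R⁻¹ • x) * p (phi n (u x))) :=
      hχR.mul_bdd hpm (ae_of_all _ fun x => hp.bound _)
    -- A Chebyshev estimate: the left integrand vanishes where `u ≤ e^{-1}` and is at most `1 ≤ e u`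
    -- elsewhere.
    have h1 : ∫ x, (χ (R⁻¹ • x) + χ (R⁻¹ • x) * p (phi n (u x))) ≤ ∫ x, Real.exp 1 * u x := by
      refine integral_mono_ae (hχR.add hi) (hu.const_mul _) ?_
      filter_upwards [hpos] with x hx
      have hχx := hχn (R⁻¹ • x)
      rcases le_or_gt (u x) (Real.exp (-1)) with h | h
      · have hphi := phi_le_neg_one hn hx h
        have : p (phi n (u x)) = -1 := by
          rw [hpdef]
          simp only
          rw [Real.smoothTransition.one_of_one_le (by linarith)]
        simp only [this]
        have : 0 ≤ Real.exp 1 * u x := by positivity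
        linarith
      · have h2 : 1 ≤ Real.exp 1 * u x := by
          have := mul_le_mul_of_nonneg_left h.le (Real.exp_pos 1).le
          rwa [← Real.exp_add, add_neg_cancel, Real.exp_zero] at this
        have h3 : p (phi n (u x)) ≤ 0 := neg_nonpos.2 (Real.smoothTransition.nonneg _)
        have h4 := mul_nonpos_of_nonneg_of_nonpos hχx h3
        have h5 := hχ1 (R⁻¹ • x)
        linarith
    rw [integral_add hχR hi, hsc, integral_const_mul] at h1
    have h2 := (abs_le.1 (hup R hR)).1
    have hRN : 0 < R ^ N := by positivity
    have h3 : R ^ N * ∫ x, χ x ≤ Real.exp 1 * (∫ x, u x)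
        + R ^ N * (R ^ (s - N / 2) * (C * (L * norm2 g))) := by linarith
    calc ∫ x, χ x = (R ^ N)⁻¹ * (R ^ N * ∫ x, χ x) := by rw [inv_mul_cancel_left₀ hRN.ne']
      _ ≤ (R ^ N)⁻¹ * (Real.exp 1 * (∫ x, u x)
          + R ^ N * (R ^ (s - N / 2) * (C * (L * norm2 g)))) :=
        mul_le_mul_of_nonneg_left h3 (by positivity)
      _ = _ := by rw [mul_add, inv_mul_cancel_left₀ hRN.ne']
  have hzero : Tendsto (fun R : ℝ => (R ^ N)⁻¹ * (Real.exp 1 * ∫ x, u x)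
      + R ^ (s - N / 2) * (C * (L * norm2 g))) atTop (𝓝 0) := by
    have h1 : Tendsto (fun R : ℝ => (R ^ N)⁻¹) atTop (𝓝 0) :=
      (tendsto_pow_atTop (by omega)).inv_tendsto_atTop
    have h2 : Tendsto (fun R : ℝ => R ^ (s - N / 2)) atTop (𝓝 0) := by
      have := tendsto_rpow_neg_atTop (show 0 < (N : ℝ) / 2 - s by linarith)
      simpa using this
    simpa using (h1.mul_const _).add (h2.mul_const _)
  have := ge_of_tendsto hzero ((eventually_gt_atTop 0).mono hmain)
  linarith

/-! ### Comparison -/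

theorem phi_strictMonoOn {n : ℝ} (hn : 0 ≤ n) : StrictMonoOn (phi n) (Ioi 0) := by
  intro x hx y hy hxy
  have hx0 : 0 < x := hx
  unfold phi
  split_ifs with h
  · exact Real.log_lt_log hx0 hxy
  · exact neg_lt_neg (Real.rpow_lt_rpow_of_neg hx0 hxy (neg_lt_zero.2 (hn.lt_of_ne' h)))

theorem HasHalfLap.sub {N : ℕ} {s : ℝ} {w w' g g' : Space N → ℝ} (hN : 1 ≤ N) (hs : 0 < s)
    (hs1 : s < 1) (hw : HasHalfLap s w g) (hw' : HasHalfLap s w' g') :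
    HasHalfLap s (fun x => w x - w' x) (fun x => g x - g' x) := by
  obtain ⟨ψ, hψ, hloc, hL2⟩ := hw.approx
  obtain ⟨ψ', hψ', hloc', hL2'⟩ := hw'.approx
  refine ⟨hw.locallyIntegrable.sub hw'.locallyIntegrable, hw.memLp.sub hw'.memLp,
    fun k x => ψ k x - ψ' k x, fun k => (hψ k).sub (hψ' k), fun K hK => ?_, ?_⟩
  · have h0 := (hloc K hK).add (hloc' K hK)
    rw [add_zero] at h0
    refine tendsto_of_tendsto_of_tendsto_of_le_of_le tendsto_const_nhds h0 (fun k => zero_le)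
      fun k => ?_
    have e : (fun x => ψ k x - ψ' k x - (w x - w' x))
        = (fun x => ψ k x - w x) - fun x => ψ' k x - w' x := by ext x; simp; ring
    rw [e]
    exact eLpNorm_sub_le ((hψ k).continuous.aestronglyMeasurable.sub
      hw.locallyIntegrable.aestronglyMeasurable.restrict)
      ((hψ' k).continuous.aestronglyMeasurable.sub
        hw'.locallyIntegrable.aestronglyMeasurable.restrict) le_rfl
  · have h0 := hL2.add hL2'
    rw [add_zero] at h0
    refine tendsto_of_tendsto_of_tendsto_of_le_of_le tendsto_const_nhds h0 (fun k => zero_le)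
      fun k => ?_
    have e : (fun x => fracLap (s / 2) (fun x => ψ k x - ψ' k x) x - (g x - g' x))
        = (fun x => fracLap (s / 2) (ψ k) x - g x) - fun x => fracLap (s / 2) (ψ' k) x - g' x := by
      ext x; simp only [(hψ k).fracLap_sub hN (hψ' k) hs hs1, Pi.sub_apply]; ring
    rw [e]
    exact eLpNorm_sub_le (((hψ k).memLp_fracLap hN hs hs1).sub hw.memLp).1
      (((hψ' k).memLp_fracLap hN hs hs1).sub hw'.memLp).1 (by norm_num)

/-- Comparison of a weak solution with a weak solution of the displaced problem. -/
theorem IsWeakSolution.integral_max_sub_le {N : ℕ} {s n ε : ℝ} {f f' u v : Space N → ℝ}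
    (hN : 1 ≤ N) (hs : 0 < s) (hs1 : s < 1) (hn : 0 ≤ n) (hε : 0 < ε) (hf : Integrable f)
    (hf' : Integrable f') (hu : IsWeakSolution s n f u) (hv : IsShiftedWeakSolution s n ε f' v) :
    ∫ x, max (u x - v x - ε) 0 ≤ ∫ x, |f' x - f x| := by
  obtain ⟨hupos, hui, g, hg, hgeq⟩ := hu
  obtain ⟨hvpos, hvi, g', hg', hgeq'⟩ := hv
  -- In the opposite range the weak solution `u` cannot exist.
  have hNs : (N : ℝ) ≤ 2 * s := by
    by_contra hc
    exact not_hasHalfLap_phi hN hs hs1 hn (not_le.1 hc) hui hupos hg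
  set W : Space N → ℝ := fun x => phi n (u x) - phiShift n ε (v x) with hWdef
  set h : Space N → ℝ := fun x => (u x - v x) - (f x - f' x) with hhdef
  have huv : Integrable (fun x => u x - v x) := hui.sub hvi
  have hff : Integrable (fun x => f x - f' x) := hf.sub hf'
  have hW : HasHalfLap s W (fun x => g x - g' x) := hg.sub hN hs hs1 hg'
  have hh : Integrable h := huv.sub hff
  have heq : ∀ ψ, IsTest ψ →
      (∫ x, h x * ψ x) + (∫ x, (g x - g' x) * fracLap (s / 2) ψ x) = 0 := by
    intro ψ hψ
    have hT := hψ.memLp_fracLap hN hs hs1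
    obtain ⟨B, hB⟩ := hψ.2.exists_bound_of_continuous hψ.continuous
    have hmul : ∀ k : Space N → ℝ, Integrable k → Integrable (fun x => k x * ψ x) := fun k hk =>
      hk.mul_bdd hψ.continuous.aestronglyMeasurable (ae_of_all _ hB)
    have e1 : ∫ x, h x * ψ x = ((∫ x, u x * ψ x) - ∫ x, v x * ψ x)
        - ((∫ x, f x * ψ x) - ∫ x, f' x * ψ x) := by
      rw [← integral_sub (hmul _ hui) (hmul _ hvi), ← integral_sub (hmul _ hf) (hmul _ hf'),
        ← integral_sub (f := fun x => u x * ψ x - v x * ψ x)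
          (g := fun x => f x * ψ x - f' x * ψ x)
          ((hmul _ hui).sub (hmul _ hvi)) ((hmul _ hf).sub (hmul _ hf'))]
      refine integral_congr_ae (ae_of_all _ fun x => ?_)
      simp only [hhdef]; ring
    have e2 : ∫ x, (g x - g' x) * fracLap (s / 2) ψ x
        = (∫ x, g x * fracLap (s / 2) ψ x) - ∫ x, g' x * fracLap (s / 2) ψ x := by
      rw [← integral_sub (integrable_mul_of_memLp_two hg.memLp hT)
        (integrable_mul_of_memLp_two hg'.memLp hT)]
      refine integral_congr_ae (ae_of_all _ fun x => ?_)
      ring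
    have := hgeq ψ hψ
    have := hgeq' ψ hψ
    linarith
  have hmass : ∫ x, h x = 0 := hW.integral_eq_zero hN hs hs1 hNs hh heq
  -- The jump sits at `φ(ε)` because `W - φ(ε) = φ(u) - φ(v + ε)` has the sign of `u - v - ε`.
  set q : ℕ → ℝ → ℝ := fun j t => Real.smoothTransition (j * (t - phi n ε)) with hqdef
  have hq0 : ∀ j t, 0 ≤ q j t := fun j t => Real.smoothTransition.nonneg _
  have hq1 : ∀ j t, q j t ≤ 1 := fun j t => Real.smoothTransition.le_one _
  have hqabs : ∀ j t, ‖q j t‖ ≤ 1 := fun j t => by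
    rw [Real.norm_of_nonneg (hq0 j t)]; exact hq1 j t
  have hqm : ∀ j, AEStronglyMeasurable (fun x => q j (W x)) := fun j =>
    (show Continuous (q j) from Real.smoothTransition.continuous.comp
      (by fun_prop)).comp_aestronglyMeasurable hW.locallyIntegrable.aestronglyMeasurable
  have hqi : ∀ (k : Space N → ℝ) j, Integrable k → Integrable (fun x => k x * q j (W x)) :=
    fun k j hk => hk.mul_bdd (hqm j) (ae_of_all _ fun x => hqabs j _)
  have hstep : ∀ j : ℕ, ∫ x, (u x - v x) * q j (W x) ≤ ∫ x, |f' x - f x| := by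
    intro j
    obtain ⟨L, hp⟩ := exists_isTruncation_steep j (phi n ε) j.cast_nonneg
    have h1 := hW.integral_mul_comp_nonpos hN hs hs1 hh heq hp (by simp)
    -- Conservation of mass removes the normalising constant.
    have h2 : ∫ x, h x * (q j (W x) - q j 0) = ∫ x, h x * q j (W x) := by
      simp only [mul_sub]
      rw [integral_sub (hqi h j hh) (hh.mul_const _), integral_mul_const, hmass, zero_mul, sub_zero]
    have h3 : ∫ x, h x * q j (W x) = (∫ x, (u x - v x) * q j (W x))
        - ∫ x, (f x - f' x) * q j (W x) := by
      rw [← integral_sub (hqi _ j huv) (hqi _ j hff)]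
      refine integral_congr_ae (ae_of_all _ fun x => ?_)
      simp only [hhdef]; ring
    have h4 : ∫ x, (f x - f' x) * q j (W x) ≤ ∫ x, |f' x - f x| := by
      refine integral_mono (hqi _ j hff) (hf'.sub hf).abs fun x => ?_
      rw [abs_sub_comm]
      exact (mul_le_mul_of_nonneg_right (le_abs_self _) (hq0 j _)).trans
        (mul_le_of_le_one_right (abs_nonneg _) (hq1 j _))
    have h5 : ∫ x, h x * (q j (W x) - q j 0) ≤ 0 := h1
    linarith
  -- Almost everywhere the sequence is eventually constant. At `u = v + ε` the factor is zero
  -- because the transition function vanishes at `0`.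
  have hlim : Tendsto (fun j => ∫ x, (u x - v x) * q j (W x)) atTop
      (𝓝 (∫ x, if v x + ε < u x then u x - v x else 0)) := by
    refine tendsto_integral_of_dominated_convergence (fun x => ‖u x - v x‖)
      (fun j => (hqi _ j huv).1) huv.norm
      (fun j => ae_of_all _ fun x => ?_) ?_
    · rw [norm_mul]
      exact mul_le_of_le_one_right (norm_nonneg _) (hqabs j _)
    · filter_upwards [hupos, hvpos] with x hux hvx
      split_ifs with hlt
      · have hWx : 0 < W x - phi n ε := by
          have := phi_strictMonoOn hn (mem_Ioi.2 hvx) (mem_Ioi.2 hux) hlt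
          simp only [hWdef, phiShift]; linarith
        obtain ⟨j₀, hj₀⟩ := exists_nat_gt (1 / (W x - phi n ε))
        refine tendsto_const_nhds.congr' ?_
        filter_upwards [eventually_ge_atTop j₀] with j hj
        have h1 : 1 ≤ (j : ℝ) * (W x - phi n ε) := by
          have : (1 : ℝ) / (W x - phi n ε) ≤ j := hj₀.le.trans (by exact_mod_cast hj)
          rwa [div_le_iff₀ hWx] at this
        simp [hqdef, Real.smoothTransition.one_of_one_le h1]
      · have hWx : W x - phi n ε ≤ 0 := by
          have := (phi_strictMonoOn hn).monotoneOn (mem_Ioi.2 hux) (mem_Ioi.2 hvx) (not_lt.1 hlt)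
          simp only [hWdef, phiShift]; linarith
        refine tendsto_const_nhds.congr fun j => ?_
        simp [hqdef, Real.smoothTransition.zero_of_nonpos
          (mul_nonpos_of_nonneg_of_nonpos (Nat.cast_nonneg (α := ℝ) j) hWx)]
  have hI : Integrable (fun x => if v x + ε < u x then u x - v x else 0) := by
    refine huv.mono ?_ (ae_of_all _ fun x => ?_)
    · have hm : NullMeasurableSet {x | v x + ε < u x} :=
        nullMeasurableSet_lt (hvi.1.aemeasurable.add_const ε) hui.1.aemeasurable
      exact (huv.1.indicator₀ hm).congr (ae_of_all _ fun x => by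
        simp only [indicator, mem_ofPred_eq])
    · split_ifs
      · exact le_rfl
      · simp
  refine le_trans (integral_mono_of_nonneg (ae_of_all _ fun x => le_max_right _ _) hI
    (ae_of_all _ fun x => ?_)) (le_of_tendsto' hlim hstep)
  simp only
  split_ifs with hlt
  · exact max_le (by linarith) (by linarith)
  · exact max_le (by linarith) le_rfl

end

end SingularDiffusion

/-! ### Passage to the limit in the approximating data -/

theorem proposition9p3 (N : ℕ) (hN : 1 ≤ N) (s n ε : ℝ) (hs : 0 < s) (hs' : s < 1)
    (hn : 0 ≤ n) (hε : 0 < ε)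
    (f : SingularDiffusion.Space N → ℝ) (hf : Integrable f volume)
    (u : SingularDiffusion.Space N → ℝ) (hu : SingularDiffusion.IsWeakSolution s n f u)
    (uε : SingularDiffusion.Space N → ℝ)
    (huε : SingularDiffusion.IsApproxSolution s n ε f uε) :
    ∀ᵐ x, u x ≤ uε x := by
  obtain ⟨hvi, fk, vk, hfk, hvk, hflim, hvlim⟩ := huε
  have hui : Integrable u := hu.2.1
  -- Split `u - u_ε = (u - v_k - ε) + (v_k - (u_ε - ε))`: the comparison estimate bounds the
  -- positive part of the first term, and the second tends to zero in `L¹`.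
  have hkey : ∀ k, ∫⁻ x, ENNReal.ofReal (u x - uε x) ≤
      eLpNorm (fun x => fk k x - f x) 1 volume
        + eLpNorm (fun x => vk k x - (uε x - ε)) 1 volume := by
    intro k
    have hvki : Integrable (vk k) := (hvk k).2.1
    have h1 := hu.integral_max_sub_le hN hs hs' hn hε hf (hfk k) (hvk k)
    have hmax : Integrable (fun x => max (u x - vk k x - ε) 0) := by
      refine (hui.sub hvki).mono ((((hui.sub hvki).1.sub aestronglyMeasurable_const).sup
        aestronglyMeasurable_const)) (ae_of_all _ fun x => ?_)
      rw [Real.norm_of_nonneg (le_max_right _ _), Pi.sub_apply, Real.norm_eq_abs]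
      exact max_le (by linarith [le_abs_self (u x - vk k x)]) (abs_nonneg _)
    have h2 : ∫⁻ x, ENNReal.ofReal (max (u x - vk k x - ε) 0)
        ≤ eLpNorm (fun x => fk k x - f x) 1 volume := by
      rw [← ofReal_integral_eq_lintegral_ofReal hmax (ae_of_all _ fun x => le_max_right _ _),
        eLpNorm_one_eq_lintegral_enorm,
        ← ofReal_integral_norm_eq_lintegral_enorm (f := fun x => fk k x - f x) ((hfk k).sub hf)]
      exact ENNReal.ofReal_le_ofReal h1
    calc ∫⁻ x, ENNReal.ofReal (u x - uε x)
        ≤ ∫⁻ x, (ENNReal.ofReal (max (u x - vk k x - ε) 0) + ‖vk k x - (uε x - ε)‖ₑ) := by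
          refine lintegral_mono fun x => ?_
          rw [← ofReal_norm, ← ENNReal.ofReal_add (le_max_right _ _) (norm_nonneg _)]
          refine ENNReal.ofReal_le_ofReal ?_
          have h3 := le_max_left (u x - vk k x - ε) 0
          have h4 := le_abs_self (vk k x - (uε x - ε))
          rw [Real.norm_eq_abs]
          linarith
      _ = (∫⁻ x, ENNReal.ofReal (max (u x - vk k x - ε) 0))
          + ∫⁻ x, ‖vk k x - (uε x - ε)‖ₑ :=
          lintegral_add_right' _ (hvki.sub hvi).1.enorm
      _ ≤ _ := by
          rw [eLpNorm_one_eq_lintegral_enorm (f := fun x => vk k x - (uε x - ε))]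
          exact add_le_add_left h2 _
  have h0 : ∫⁻ x, ENNReal.ofReal (u x - uε x) = 0 := by
    have hlim := hflim.add hvlim
    rw [add_zero] at hlim
    exact le_antisymm (ge_of_tendsto' hlim hkey) zero_le
  have hm : AEMeasurable (fun x => ENNReal.ofReal (u x - uε x)) := by
    have : AEMeasurable uε := by
      simpa using hvi.1.aemeasurable.add_const ε
    exact (hui.1.aemeasurable.sub this).ennreal_ofReal
  filter_upwards [(lintegral_eq_zero_iff' hm).1 h0] with x hx
  have := ENNReal.ofReal_eq_zero.1 hx
  linarith
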